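/- Let $P=-i\,d/dx$ and let $Q$ be multiplication by $x$ in $L^2(\mathbb R)$. Let $f,g:\mathbb R\to\mathbb R$ be bounded measurable functions, each of which is non-decreasing (possibly after modification on a Lebesgue null set). Suppose that the bounded operator $C=i[f(P),g(Q)]$ on $L^2(\mathbb R)$ is positive, that is $(\psi,C\psi)\ge 0$ for all $\psi\in L^2(\mathbb R)$, and that $C\ne 0$. Then there are continuous, strictly increasing functions $F,G:\mathbb R\to\mathbb R$ with $F=f$ and $G=g$ almost everywhere, such that: 1. the inverse functions $F^{-1}$ and $G^{-1}$, which are defined on the open intervals $F(\mathbb R)$ and $G(\mathbb R)$, are absolutely continuous on every compact subinterval of their domains; 2. with $$K(x,y)=\frac1{\sqrt{2\pi}}\,\frac{G(x)-G(y)}{x-y}\,\widehat{dF}(y-x),\qquad \widehat{dF}(s)=\frac1{\sqrt{2\pi}}\int_{\mathbb R} e^{-is\xi}\,dF(\xi),$$ the kernel $K$ is square integrable on $\mathbb R^2$, and for every $\psi\in L^2(\mathbb R)$ one has $(C\psi)(x)=\int_{\mathbb R}K(x,y)\psi(y)\,dy$ for almost every $x$; 3. $C$ is trace class and $\operatorname{tr}C=[F][G]/2\pi$,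 where $[F]=\lim_{x\to\infty}F(x)-\lim_{x\to-\infty}F(x)$ and $[G]$ is defined likewise. -/

import Mathlib

open MeasureTheory
open scoped ENNReal

noncomputable section

namespace KatoCommutator

/-- The Hilbert space `L²(ℝ)` of complex-valued square-integrable functions. -/
abbrev L2 : Type := Lp ℂ 2 (volume : Measure ℝ)

theorem memLp_top_ofReal (φ : ℝ → ℝ) (hm : Measurable φ) (hb : ∃ M, ∀ x, |φ x| ≤ M) :
    MemLp (fun x => (φ x : ℂ)) ∞ (volume : Measure ℝ) := by
  obtain ⟨M, hM⟩ := hb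
  refine memLp_top_of_bound (Complex.measurable_ofReal.comp hm).aestronglyMeasurable M
    (ae_of_all _ fun x => ?_)
  simpa using hM x

/-- `φ(Q)`: the operator of multiplication by the bounded measurable real function `φ`,
where `Q` is multiplication by `x`. -/
def funQ (φ : ℝ → ℝ) (hm : Measurable φ) (hb : ∃ M, ∀ x, |φ x| ≤ M) : L2 →L[ℂ] L2 :=
  (ContinuousLinearMap.mul ℂ ℂ).holderL volume ∞ 2 2 ((memLp_top_ofReal φ hm hb).toLp _)

theorem funQ_apply_ae (φ : ℝ → ℝ) (hm : Measurable φ) (hb : ∃ M, ∀ x, |φ x| ≤ M) (ψ : L2) :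
    funQ φ hm hb ψ =ᵐ[volume] fun x => (φ x : ℂ) * ψ x := by
  have h1 := (ContinuousLinearMap.mul ℂ ℂ).coeFn_holder (r := 2)
    ((memLp_top_ofReal φ hm hb).toLp _) ψ
  filter_upwards [h1, (memLp_top_ofReal φ hm hb).coeFn_toLp] with x hx hx'
  simp only [funQ, ContinuousLinearMap.holderL_apply_apply]
  rw [hx, hx']
  rfl

/-- `φ(P)` for `P = -i d/dx` and a bounded measurable real function `φ`. Mathlib's Fourier
transform has kernel `exp (-2πixξ)`, so that it turns `P` into multiplication by `2πξ`, and
`φ(P)` into multiplication by `φ(2πξ)`. -/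
def funP (φ : ℝ → ℝ) (hm : Measurable φ) (hb : ∃ M, ∀ x, |φ x| ≤ M) : L2 →L[ℂ] L2 :=
  let U : L2 ≃ₗᵢ[ℂ] L2 := Lp.fourierTransformₗᵢ ℝ ℂ
  (U.symm.toContinuousLinearEquiv : L2 →L[ℂ] L2) ∘L
    funQ (fun ξ => φ (2 * Real.pi * ξ)) (hm.comp (measurable_const_mul _))
      (hb.imp fun _ h ξ => h (2 * Real.pi * ξ)) ∘L
    (U.toContinuousLinearEquiv : L2 →L[ℂ] L2)

/-- The operator `i [f(P), g(Q)]`. -/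
def commutator (f g : ℝ → ℝ) (hf : Measurable f) (hfb : ∃ M, ∀ x, |f x| ≤ M)
    (hg : Measurable g) (hgb : ∃ M, ∀ x, |g x| ≤ M) : L2 →L[ℂ] L2 :=
  Complex.I • (funP f hf hfb ∘L funQ g hg hgb - funQ g hg hgb ∘L funP f hf hfb)

/-- The Fourier transform `(2π)^(-1/2) ∫ exp (-isξ) dF(ξ)` of the Stieltjes measure `dF` of a
monotone function `F`. -/
def fourierStieltjes (F : ℝ → ℝ) (hF : Monotone F) (s : ℝ) : ℂ :=
  ((1 / Real.sqrt (2 * Real.pi) : ℝ) : ℂ) *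
    ∫ ξ : ℝ, Complex.exp (-(Complex.I * s * ξ)) ∂hF.stieltjesFunction.measure

/-- The kernel `(2π)^(-1/2) (G(x) - G(y)) / (x - y) · (dF)^(y - x)`. Its value on the diagonal,
which is a null set, is irrelevant. -/
def kernel (F G : ℝ → ℝ) (hF : Monotone F) (x y : ℝ) : ℂ :=
  ((1 / Real.sqrt (2 * Real.pi) : ℝ) : ℂ) * (((G x - G y) / (x - y) : ℝ) : ℂ) *
    fourierStieltjes F hF (y - x)

/-- The total variation `[F] = F(∞) - F(-∞)` of a bounded monotone function. -/
def totalIncrease (F : ℝ → ℝ) : ℝ := (⨆ x, F x) - ⨅ x, F x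

/-- The positive operator `C` on `L²(ℝ)` is trace class with trace `t`: the sum of its diagonal
entries converges to `t` in every orthonormal basis. -/
def IsTraceClassWithTrace (C : L2 →L[ℂ] L2) (t : ℝ) : Prop :=
  C.IsPositive ∧ ∀ (ι : Type) (e : HilbertBasis ι ℂ L2),
    HasSum (fun i => inner ℂ (e i) (C (e i))) (t : ℂ)

/-- The inverse function, defined on the range (an open interval) of a strictly increasing
continuous function `F`, is absolutely continuous, that is, absolutely continuous on every
compact subinterval of its domain. -/
def InverseAbsolutelyContinuous (F : ℝ → ℝ) : Prop :=
  ∀ c ∈ Set.range F, ∀ d ∈ Set.range F,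
    AbsolutelyContinuousOnInterval (Function.invFun F) c d

end KatoCommutator

end

open Filter Topology FourierTransform ComplexConjugate

noncomputable section

namespace KatoCommutator

/-! Positivity gives C = S² with S ≥ 0. For an orthonormal basis (eᵢ), the function D = ∑ |S eᵢ|²
plays the role of the diagonal of the kernel of C. Let φ be a real test function and φ_ξ(x) =
exp(2πiξx) φ(x). Parseval and Plancherel give ∫ (φ_ξ, C φ_ξ) dξ = ∫ D φ² (`lintegral_density_mul`).
The left side can also be computed directly. Modulation translates Fourier transforms, so (φ_ξ, C
φ_ξ) is i times the integral of f(2π(t + ξ)) against a function m(t) with ∫ m = 0. Integration over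
ξ then sees only the limits of f at ±∞: it yields [f] times the first moment of m, which by
Plancherel is -([f]/π) ∫ g φ φ' (`tendsto_integral_inner_modulate`). Hence D = ([f]/2π) g' as
distributions. Since D ≥ 0 and g is bounded, D is integrable; thus g has a continuous, locally
absolutely continuous representative G, and tr C = ∫ D = [f][G]/2π. Moreover Cψ = 0 a.e. where D =
0, which forces [f] > 0 when C ≠ 0.

Conjugation by the Fourier transform exchanges position and momentum and preserves positivity
(`commutator_swap`), so the same holds for f.

When F and G are primitives of integrable densities, integration by parts in momentum space shows
that the matrix elements of C between indicators of bounded sets are the integrals of K over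
rectangles (`inner_commutator_indicator`). A positive trace class operator is Hilbert-Schmidt, so C
has some square integrable kernel; it has the same rectangle integrals and is therefore K
(`kernel_hilbertSchmidt`).

Finally G' > 0 a.e. Where G' vanishes, so does the row K(x, ·) for almost every such x. As the
Fourier transform of dF is nonzero near 0, G is constant within a fixed distance δ of x. If one such
x existed, a connectedness argument would make G constant and C zero (`density_pos_or_const`). A
positive density makes G strictly increasing and its inverse absolutely continuous. -/

/-- The unitary Fourier transform of `L²(ℝ)`. -/
abbrev FT : L2 ≃ₗᵢ[ℂ] L2 := Lp.fourierTransformₗᵢ ℝ ℂ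

/-! ### The L² Fourier transform as an integral, and its inverse as a reflection -/

theorem FT_toLp_ae {h : ℝ → ℂ} (h1 : Integrable h) (h2 : MemLp h 2 volume) :
    FT (h2.toLp h) =ᵐ[volume] 𝓕 h := by
  have hcont : Continuous (𝓕 h) :=
    VectorFourier.fourierIntegral_continuous Real.continuous_fourierChar
      (by exact continuous_inner) h1
  -- Both sides are tested against smooth compactly supported functions: the transpose identity for
  -- tempered distributions moves the transform off the left side, Fubini off the right.
  refine ae_eq_of_integral_contDiff_smul_eq
    ((Lp.memLp _).locallyIntegrable (by norm_num)) hcont.locallyIntegrable fun g hg hgs => ?_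
  have hg1 : HasCompactSupport (Complex.ofRealCLM ∘ g) := hgs.comp_left rfl
  have hg2 : ContDiff ℝ (⊤ : ℕ∞) (Complex.ofRealCLM ∘ g) :=
    Complex.ofRealCLM.contDiff.comp hg
  set θ := hg1.toSchwartzMap hg2 with hθ
  have e1 : ∫ x, g x • FT (h2.toLp h) x = Lp.toTemperedDistribution (FT (h2.toLp h)) θ := by
    simp [hθ]
  have e2 : Lp.toTemperedDistribution (FT (h2.toLp h)) θ
      = Lp.toTemperedDistribution (h2.toLp h) (𝓕 θ) := by
    have := Lp.fourier_toTemperedDistribution_eq (h2.toLp h)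
    exact (congrArg (fun T => T θ) this).symm
  rw [e1, e2, Lp.toTemperedDistribution_apply]
  have e3 : ∫ x, (𝓕 θ) x • (h2.toLp h) x = ∫ x, (𝓕 (θ : ℝ → ℂ)) x • h x := by
    refine integral_congr_ae ?_
    filter_upwards [h2.coeFn_toLp] with x hx
    rw [hx, SchwartzMap.fourier_coe]
  rw [e3]
  have := VectorFourier.integral_fourierIntegral_smul_eq_flip (μ := volume) (ν := volume)
    (L := (innerₗ ℝ : ℝ →ₗ[ℝ] ℝ →ₗ[ℝ] ℝ)) (f := (θ : ℝ → ℂ)) (g := h)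
    Real.continuous_fourierChar (by exact continuous_inner) θ.integrable h1
  rw [flip_innerₗ] at this
  refine this.trans ?_
  refine integral_congr_ae (ae_of_all _ fun x => ?_)
  change (g x : ℂ) * 𝓕 h x = g x • 𝓕 h x
  rw [Complex.real_smul]

/-- The reflection `ψ ↦ ψ (-·)` on `L²(ℝ)`. -/
def reflect : L2 →ₗᵢ[ℂ] L2 :=
  Lp.compMeasurePreservingₗᵢ ℂ (fun x : ℝ => -x) (Measure.measurePreserving_neg volume)

theorem reflect_ae (ψ : L2) : reflect ψ =ᵐ[volume] fun x => ψ (-x) :=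
  Lp.coeFn_compMeasurePreserving ψ (Measure.measurePreserving_neg volume)

/-- Both sides are continuous, and on the dense set of Schwartz functions they are explicit
integrals. The reflection is the source of the signs in the exchanged pair of `commutator_swap`. -/
theorem FT_symm_eq (ψ : L2) : FT.symm ψ = reflect (FT ψ) := by
  refine DenseRange.induction_on (p := fun ψ : L2 => FT.symm ψ = reflect (FT ψ))
    (SchwartzMap.denseRange_toLpCLM (E := ℝ) (F := ℂ) (p := 2) (μ := volume)
      ENNReal.ofNat_ne_top) ψ
    (isClosed_eq FT.symm.continuous (reflect.continuous.comp FT.continuous)) fun θ => ?_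
  change FT.symm (SchwartzMap.toLpCLM ℂ ℂ 2 volume θ)
    = reflect (FT (SchwartzMap.toLpCLM ℂ ℂ 2 volume θ))
  have e1 : FT.symm (SchwartzMap.toLpCLM ℂ ℂ 2 volume θ) = (𝓕⁻ θ).toLp 2 :=
    SchwartzMap.toLp_fourierInv_eq θ
  have e2 : FT (SchwartzMap.toLpCLM ℂ ℂ 2 volume θ) = (𝓕 θ).toLp 2 :=
    SchwartzMap.toLp_fourier_eq θ
  rw [e1, e2]
  refine Lp.ext ?_
  have h1 := (Measure.measurePreserving_neg (volume : Measure ℝ)).quasiMeasurePreserving.ae_eq_comp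
    ((𝓕 θ).coeFn_toLp 2 volume)
  filter_upwards [(𝓕⁻ θ).coeFn_toLp 2 volume, reflect_ae ((𝓕 θ).toLp 2), h1] with x a b c
  simp only [Function.comp_apply] at c
  rw [a, b, c]
  simp [SchwartzMap.fourier_coe, SchwartzMap.fourierInv_coe, Real.fourierInv_eq_fourier_neg]

/-! ### The commutator as a form, and the exchange of position and momentum -/

section commutator

variable {f g : ℝ → ℝ} (hf : Measurable f) (hfb : ∃ M, ∀ x, |f x| ≤ M)
  (hg : Measurable g) (hgb : ∃ M, ∀ x, |g x| ≤ M)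

theorem funQ_congr {f f' : ℝ → ℝ} (hf : Measurable f) (hfb : ∃ M, ∀ x, |f x| ≤ M)
    (hf' : Measurable f') (hfb' : ∃ M, ∀ x, |f' x| ≤ M) (h : f =ᵐ[volume] f') :
    funQ f hf hfb = funQ f' hf' hfb' := by
  refine ContinuousLinearMap.ext fun ψ => Lp.ext ?_
  filter_upwards [funQ_apply_ae f hf hfb ψ, funQ_apply_ae f' hf' hfb' ψ, h] with x a b c
  rw [a, b, c]

theorem commutator_congr {f' g' : ℝ → ℝ} (hf' : Measurable f') (hfb' : ∃ M, ∀ x, |f' x| ≤ M)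
    (hg' : Measurable g') (hgb' : ∃ M, ∀ x, |g' x| ≤ M) (h : f =ᵐ[volume] f')
    (h' : g =ᵐ[volume] g') :
    commutator f g hf hfb hg hgb = commutator f' g' hf' hfb' hg' hgb' := by
  have e1 : funP f hf hfb = funP f' hf' hfb' := by
    unfold funP
    have h2 : (fun ξ => f (2 * Real.pi * ξ)) =ᵐ[volume] fun ξ => f' (2 * Real.pi * ξ) := by
      have : Measure.QuasiMeasurePreserving (fun ξ : ℝ => 2 * Real.pi * ξ) volume volume := by
        refine ⟨measurable_const_mul _, ?_⟩
        rw [Real.map_volume_mul_left (by positivity)]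
        exact Measure.smul_absolutelyContinuous
      exact this.ae_eq_comp h
    rw [funQ_congr _ _ _ _ h2]
  unfold commutator
  rw [e1, funQ_congr hg hgb hg' hgb' h']

theorem inner_funQ_left (φ ψ : L2) :
    inner ℂ (funQ g hg hgb φ) ψ = inner ℂ φ (funQ g hg hgb ψ) := by
  rw [L2.inner_def, L2.inner_def]
  refine integral_congr_ae ?_
  filter_upwards [funQ_apply_ae g hg hgb φ, funQ_apply_ae g hg hgb ψ] with x a b
  rw [a, b]
  simp
  ring

/-- Multiplication by g is moved onto the vectors, so that f enters only as a bounded weight in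
momentum space; no regularity of f or g is needed. -/
theorem inner_commutator (φ ψ : L2) :
    inner ℂ φ (commutator f g hf hfb hg hgb ψ) = Complex.I * ∫ t, (f (2 * Real.pi * t) : ℂ) *
      (conj (FT φ t) * FT (funQ g hg hgb ψ) t - conj (FT (funQ g hg hgb φ) t) * FT ψ t) := by
  have hu : Measurable fun t => f (2 * Real.pi * t) := hf.comp (measurable_const_mul _)
  have hub : ∃ M, ∀ t, |f (2 * Real.pi * t)| ≤ M := hfb.imp fun _ h ξ => h _
  have key : ∀ a b : L2, inner ℂ a (funP f hf hfb b)
      = inner ℂ (FT a) (funQ (fun t => f (2 * Real.pi * t)) hu hub (FT b)) := by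
    intro a b
    rw [← FT.inner_map_map]
    congr 1
    exact FT.apply_symm_apply _
  have e : commutator f g hf hfb hg hgb ψ = Complex.I •
      (funP f hf hfb (funQ g hg hgb ψ) - funQ g hg hgb (funP f hf hfb ψ)) := rfl
  rw [e, inner_smul_right, inner_sub_right, ← inner_funQ_left, key, key, L2.inner_def, L2.inner_def,
    ← integral_sub (L2.integrable_inner _ _) (L2.integrable_inner _ _)]
  congr 1
  refine integral_congr_ae ?_
  filter_upwards [funQ_apply_ae _ hu hub (FT (funQ g hg hgb ψ)), funQ_apply_ae _ hu hub (FT ψ)]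
    with x a b
  rw [a, b]
  simp
  ring

/-- Conjugation by the transform U turns g(Q) into a function of P. It turns f(P) into U⁻² f(2πQ)
U², which is multiplication by f(-2πx) because U² is the reflection. The order of the two factors is
thereby reversed, and the minus sign in the second function restores the form i[f'(P), g'(Q)]. -/
theorem commutator_swap (hf' : Measurable fun x => g (x / (2 * Real.pi)))
    (hfb' : ∃ M, ∀ x, |g (x / (2 * Real.pi))| ≤ M)
    (hg' : Measurable fun x => - f (-(2 * Real.pi * x)))
    (hgb' : ∃ M, ∀ x, |(- f (-(2 * Real.pi * x)))| ≤ M) (ψ : L2) :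
    commutator (fun x => g (x / (2 * Real.pi))) (fun x => - f (-(2 * Real.pi * x)))
      hf' hfb' hg' hgb' ψ = FT.symm (commutator f g hf hfb hg hgb (FT ψ)) := by
  have hu : Measurable fun t => f (2 * Real.pi * t) := hf.comp (measurable_const_mul _)
  have hub : ∃ M, ∀ t, |f (2 * Real.pi * t)| ≤ M := hfb.imp fun _ h ξ => h _
  set f' := fun x => g (x / (2 * Real.pi))
  set g' := fun x => - f (-(2 * Real.pi * x))
  have key : ∀ χ, FT.symm (funP f hf hfb (FT χ)) = - funQ g' hg' hgb' χ := by
    intro χ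
    change FT.symm (FT.symm (funQ _ hu hub (FT (FT χ)))) = _
    have h2 : ∀ a : L2, FT.symm (FT.symm a) = reflect a := fun a => by
      rw [FT_symm_eq, FT.apply_symm_apply]
    set b := FT (FT χ) with hb
    have hχ : χ = reflect b := by
      rw [← h2, hb, FT.symm_apply_apply, FT.symm_apply_apply]
    rw [h2, hχ]
    refine Lp.ext ?_
    have h1 := (Measure.measurePreserving_neg
      (volume : Measure ℝ)).quasiMeasurePreserving.ae_eq_comp (funQ_apply_ae _ hu hub b)
    filter_upwards [reflect_ae (funQ _ hu hub b), h1, Lp.coeFn_neg (funQ g' hg' hgb' (reflect b)),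
      funQ_apply_ae g' hg' hgb' (reflect b), reflect_ae b] with x a1 a2 a3 a4 a5
    simp only [Function.comp_apply] at a2
    rw [a1, a2, a3, Pi.neg_apply, a4, a5]
    simp [g']
  have key2 : ∀ χ, FT.symm (funQ g hg hgb (FT χ)) = funP f' hf' hfb' χ := by
    intro χ
    have : (funQ (fun ξ => f' (2 * Real.pi * ξ)) (hf'.comp (measurable_const_mul _))
      (hfb'.imp fun _ h ξ => h (2 * Real.pi * ξ))) = funQ g hg hgb :=
      funQ_congr _ _ _ _ (ae_of_all _ fun x => by
        simp only [f']; congr 1; field_simp)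
    unfold funP
    rw [this]
    rfl
  have e : commutator f g hf hfb hg hgb (FT ψ) = Complex.I •
      (funP f hf hfb (funQ g hg hgb (FT ψ)) - funQ g hg hgb (funP f hf hfb (FT ψ))) := rfl
  have e' : commutator f' g' hf' hfb' hg' hgb' ψ = Complex.I •
      (funP f' hf' hfb' (funQ g' hg' hgb' ψ) - funQ g' hg' hgb' (funP f' hf' hfb' ψ)) := rfl
  have k3 : FT.symm (funP f hf hfb (funQ g hg hgb (FT ψ))) = - funQ g' hg' hgb' (funP f' hf' hfb' ψ) := by
    rw [← key2, ← key, FT.apply_symm_apply]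
  have k4 : FT.symm (funQ g hg hgb (funP f hf hfb (FT ψ))) = - funP f' hf' hfb' (funQ g' hg' hgb' ψ) := by
    have : funP f hf hfb (FT ψ) = FT (- funQ g' hg' hgb' ψ) := by
      rw [← key, FT.apply_symm_apply]
    rw [this, key2, map_neg]
  rw [e, e', map_smul, map_sub, k3, k4]
  congr 1
  abel

end commutator

/-! ### Modulations -/

theorem memLp_modulate {φ : ℝ → ℂ} {p : ℝ≥0∞} (hφ : MemLp φ p volume) (ξ : ℝ) :
    MemLp (fun x => Real.fourierChar (x * ξ) • φ x) p volume := by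
  refine hφ.of_le (AEStronglyMeasurable.mul (f := fun x => ((Real.fourierChar (x * ξ) : Circle) : ℂ))
    ?_ hφ.1) (ae_of_all _ fun x => (Circle.norm_smul _ _).le)
  have : Continuous fun x : ℝ => ((Real.fourierChar (x * ξ) : Circle) : ℂ) :=
    continuous_subtype_val.comp (Real.continuous_fourierChar.comp (by fun_prop))
  exact this.aestronglyMeasurable

/-- The function `x ↦ exp (2πiξx) φ x` as an element of `L²(ℝ)`. -/
def modulate {φ : ℝ → ℂ} (hφ : MemLp φ 2 volume) (ξ : ℝ) : L2 :=
  (memLp_modulate hφ ξ).toLp _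

theorem modulate_ae {φ : ℝ → ℂ} (hφ : MemLp φ 2 volume) (ξ : ℝ) :
    modulate hφ ξ =ᵐ[volume] fun x => Real.fourierChar (x * ξ) • φ x :=
  MemLp.coeFn_toLp _

theorem FT_modulate_ae {φ : ℝ → ℂ} (h1 : Integrable φ) (h2 : MemLp φ 2 volume) (ξ : ℝ) :
    FT (modulate h2 ξ) =ᵐ[volume] fun t => 𝓕 φ (t - ξ) := by
  have hi : Integrable (fun x => Real.fourierChar (x * ξ) • φ x) := by
    rw [← memLp_one_iff_integrable] at h1 ⊢
    exact memLp_modulate h1 ξ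
  refine (FT_toLp_ae hi (memLp_modulate h2 ξ)).trans (ae_of_all _ fun t => ?_)
  change _ = 𝓕 φ (t - ξ)
  rw [Real.fourier_real_eq, Real.fourier_real_eq]
  refine integral_congr_ae (ae_of_all _ fun x => ?_)
  simp only [Circle.smul_def, smul_eq_mul, ← mul_assoc, ← Circle.coe_mul, ← AddChar.map_add_eq_mul]
  congr 4
  ring

theorem funQ_modulate {g : ℝ → ℝ} (hg : Measurable g) (hgb : ∃ M, ∀ x, |g x| ≤ M)
    {φ : ℝ → ℂ} (h : MemLp φ 2 volume) (h' : MemLp (fun x => (g x : ℂ) * φ x) 2 volume) (ξ : ℝ) :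
    funQ g hg hgb (modulate h ξ) = modulate h' ξ := by
  refine Lp.ext ?_
  filter_upwards [funQ_apply_ae g hg hgb (modulate h ξ), modulate_ae h ξ, modulate_ae h' ξ]
    with x a b c
  rw [a, b, c, Circle.smul_def, Circle.smul_def, smul_eq_mul, smul_eq_mul]
  ring

theorem lintegral_enorm_sq_eq (ψ : L2) : ∫⁻ x, ‖ψ x‖ₑ ^ 2 = ‖ψ‖ₑ ^ 2 := by
  rw [Lp.enorm_def, eLpNorm_eq_lintegral_rpow_enorm_toReal (by norm_num) (by norm_num)]
  simp only [ENNReal.toReal_ofNat, ENNReal.rpow_ofNat]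
  rw [← ENNReal.rpow_natCast, ← ENNReal.rpow_mul]
  norm_num

theorem inner_modulate (h : L2) {φ : ℝ → ℂ} (h2 : MemLp φ 2 volume) (ξ : ℝ) :
    inner ℂ h (modulate h2 ξ) = 𝓕 (fun x => conj (h x) * φ x) (-ξ) := by
  rw [L2.inner_def, Real.fourier_real_eq]
  refine integral_congr_ae ?_
  filter_upwards [modulate_ae h2 ξ] with x hx
  rw [hx]
  simp only [Circle.smul_def, smul_eq_mul, RCLike.inner_apply]
  rw [show -(x * -ξ) = x * ξ by ring]
  ring

theorem continuous_inner_modulate (h : L2) {φ : ℝ → ℂ} (h2 : MemLp φ 2 volume) :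
    Continuous fun ξ => inner ℂ h (modulate h2 ξ) := by
  have hc : MemLp (fun x => conj (h x)) 2 volume := (Lp.memLp h).star
  simp_rw [inner_modulate]
  exact (VectorFourier.fourierIntegral_continuous Real.continuous_fourierChar
    (by exact continuous_inner) (hc.integrable_mul h2)).comp continuous_neg

theorem norm_modulate {φ : ℝ → ℂ} (h2 : MemLp φ 2 volume) (ξ : ℝ) :
    ‖modulate h2 ξ‖ = ‖h2.toLp φ‖ := by
  rw [modulate, Lp.norm_toLp, Lp.norm_toLp]
  congr 1
  exact eLpNorm_congr_norm_ae (ae_of_all _ fun x => Circle.norm_smul _ _)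

/-- This is Plancherel: ξ ↦ (h, φ_ξ) is the reflected Fourier transform of conj(h) φ. Boundedness of
φ puts this product in L² as well as in L¹. -/
theorem lintegral_inner_modulate (h : L2) {φ : ℝ → ℂ} (h2 : MemLp φ 2 volume)
    (hb : MemLp φ ∞ volume) :
    ∫⁻ ξ, ‖inner ℂ h (modulate h2 ξ)‖ₑ ^ 2 = ∫⁻ x, ‖h x‖ₑ ^ 2 * ‖φ x‖ₑ ^ 2 := by
  set k : ℝ → ℂ := fun x => conj (h x) * φ x with hk
  have hc : MemLp (fun x => conj (h x)) 2 volume := (Lp.memLp h).star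
  have k1 : Integrable k := hc.integrable_mul h2
  have k2 : MemLp k 2 volume := by
    have := hb.mul (r := 2) hc
    exact this
  have e1 : ∀ ξ, inner ℂ h (modulate h2 ξ) = 𝓕 k (-ξ) := inner_modulate h h2
  simp_rw [e1]
  have e2 : ∫⁻ ξ, ‖𝓕 k (-ξ)‖ₑ ^ 2 = ∫⁻ ξ, ‖𝓕 k ξ‖ₑ ^ 2 :=
    lintegral_neg_eq_self (μ := volume) fun ξ => ‖𝓕 k ξ‖ₑ ^ 2
  have e3 : ∫⁻ ξ, ‖𝓕 k ξ‖ₑ ^ 2 = ∫⁻ ξ, ‖FT (k2.toLp k) ξ‖ₑ ^ 2 := by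
    refine lintegral_congr_ae ?_
    filter_upwards [FT_toLp_ae k1 k2] with x hx
    rw [hx]
  have e4 : ∫⁻ ξ, ‖k2.toLp k ξ‖ₑ ^ 2 = ∫⁻ x, ‖h x‖ₑ ^ 2 * ‖φ x‖ₑ ^ 2 := by
    refine lintegral_congr_ae ?_
    filter_upwards [k2.coeFn_toLp] with x hx
    rw [hx, hk]
    simp [mul_pow]
  rw [e2, e3, lintegral_enorm_sq_eq, ← e4, lintegral_enorm_sq_eq, ← ofReal_norm, ← ofReal_norm,
    FT.norm_map]

/-- Modulation commutes with g(Q) and translates Fourier transforms by ξ; a change of variable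
transfers the translation to f. -/
theorem inner_commutator_modulate {f g : ℝ → ℝ} (hf : Measurable f) (hfb : ∃ M, ∀ x, |f x| ≤ M)
    (hg : Measurable g) (hgb : ∃ M, ∀ x, |g x| ≤ M) {φ : ℝ → ℂ} (h1 : Integrable φ)
    (h2 : MemLp φ 2 volume) (h1' : Integrable fun x => (g x : ℂ) * φ x)
    (h2' : MemLp (fun x => (g x : ℂ) * φ x) 2 volume) (ξ : ℝ) :
    inner ℂ (modulate h2 ξ) (commutator f g hf hfb hg hgb (modulate h2 ξ)) =
      Complex.I * ∫ t, (f (2 * Real.pi * (t + ξ)) : ℂ) *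
        (conj (𝓕 φ t) * 𝓕 (fun x => (g x : ℂ) * φ x) t
          - conj (𝓕 (fun x => (g x : ℂ) * φ x) t) * 𝓕 φ t) := by
  rw [inner_commutator]
  congr 1
  rw [← integral_sub_right_eq_self (fun t => (f (2 * Real.pi * (t + ξ)) : ℂ) *
        (conj (𝓕 φ t) * 𝓕 (fun x => (g x : ℂ) * φ x) t
          - conj (𝓕 (fun x => (g x : ℂ) * φ x) t) * 𝓕 φ t)) ξ]
  refine integral_congr_ae ?_
  rw [funQ_modulate hg hgb h2 h2']
  filter_upwards [FT_modulate_ae h1 h2 ξ, FT_modulate_ae h1' h2' ξ] with t a b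
  rw [a, b]
  simp

/-! ### Translates of a bounded function with limits at infinity -/

theorem intervalIntegrable_of_bounded {u : ℝ → ℝ} {M : ℝ} (hu : Measurable u)
    (hM : ∀ x, |u x| ≤ M) (c d : ℝ) : IntervalIntegrable u volume c d :=
  (intervalIntegrable_const (c := M)).mono_fun hu.aestronglyMeasurable
    (ae_of_all _ fun x => (hM x).trans (le_abs_self M))

/-- After cancellation only the integrals of u over [A, A + t] and [-A, -A + t] remain, and there u
is close to its limits. -/
theorem tendsto_integral_translates {u : ℝ → ℝ} {M a b : ℝ} (hu : Measurable u)
    (hM : ∀ x, |u x| ≤ M) (ha : Tendsto u atBot (𝓝 a)) (hb : Tendsto u atTop (𝓝 b)) (t : ℝ) :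
    Tendsto (fun A : ℝ => ∫ ξ in -A..A, (u (t + ξ) - u ξ)) atTop (𝓝 ((b - a) * t)) := by
  have hii : ∀ c d, IntervalIntegrable u volume c d := intervalIntegrable_of_bounded hu hM
  have e : ∀ A : ℝ, ∫ ξ in -A..A, (u (t + ξ) - u ξ)
      = (∫ r in (0:ℝ)..t, u (r + A)) - ∫ r in (0:ℝ)..t, u (r - A) := by
    intro A
    have h1 : IntervalIntegrable (fun ξ => u (t + ξ)) volume (-A) A := 
      intervalIntegrable_of_bounded (hu.comp (measurable_const_add t)) (fun x => hM _) _ _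
    rw [intervalIntegral.integral_sub h1 (hii _ _), intervalIntegral.integral_comp_add_left,
      intervalIntegral.integral_comp_add_right, intervalIntegral.integral_comp_sub_right]
    have := intervalIntegral.integral_add_adjacent_intervals (hii (t + -A) A) (hii A (t + A))
    have h3 := intervalIntegral.integral_add_adjacent_intervals (hii (-A) (t + -A)) (hii (t + -A) A)
    rw [← this, ← h3]
    simp only [zero_add, sub_eq_add_neg]
    ring
  simp_rw [e]
  have lim : ∀ {c : ℝ} {s : ℝ → ℝ → ℝ}, (∀ A, Measurable fun r => u (s r A)) →
      (∀ r, Tendsto (fun A => u (s r A)) atTop (𝓝 c)) →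
      Tendsto (fun A => ∫ r in (0:ℝ)..t, u (s r A)) atTop (𝓝 (∫ r in (0:ℝ)..t, c)) := by
    intro c s hs hlim
    refine intervalIntegral.tendsto_integral_filter_of_dominated_convergence (fun _ => M)
      (Eventually.of_forall fun A => (hs A).aestronglyMeasurable)
      (Eventually.of_forall fun A => ae_of_all _ fun x _ => ?_) intervalIntegrable_const
      (ae_of_all _ fun x _ => hlim x)
    rw [Real.norm_eq_abs]; exact hM _
  have l1 := lim (s := fun r A => r + A) (fun A => hu.comp (measurable_add_const A))
    (fun r => hb.comp (tendsto_atTop_add_const_left _ r tendsto_id))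
  have l2 := lim (s := fun r A => r - A) (fun A => hu.comp (measurable_sub_const A))
    (fun r => ha.comp (by
      change Tendsto (fun A => r + -A) atTop atBot
      exact tendsto_atBot_add_const_left _ r tendsto_neg_atTop_atBot))
  convert l1.sub l2 using 2
  rw [intervalIntegral.integral_const, intervalIntegral.integral_const, smul_eq_mul, smul_eq_mul]
  ring

/-- The bound is uniform in A and linear in t: it is the domination needed to integrate the
preceding limit against m. -/
theorem abs_integral_translates_le {u : ℝ → ℝ} {M : ℝ} (hu : Measurable u)
    (hM : ∀ x, |u x| ≤ M) (t A : ℝ) :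
    |∫ ξ in -A..A, (u (t + ξ) - u ξ)| ≤ 2 * M * |t| := by
  have hii : ∀ c d, IntervalIntegrable u volume c d := intervalIntegrable_of_bounded hu hM
  have h1 : IntervalIntegrable (fun ξ => u (t + ξ)) volume (-A) A := 
      intervalIntegrable_of_bounded (hu.comp (measurable_const_add t)) (fun x => hM _) _ _
  rw [intervalIntegral.integral_sub h1 (hii _ _), intervalIntegral.integral_comp_add_left]
  have := intervalIntegral.integral_add_adjacent_intervals (hii (t + -A) A) (hii A (t + A))
  have h3 := intervalIntegral.integral_add_adjacent_intervals (hii (-A) (t + -A)) (hii (t + -A) A)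
  rw [← this, ← h3]
  have b1 : |∫ x in A..t + A, u x| ≤ M * |t + A - A| :=
    intervalIntegral.norm_integral_le_of_norm_le_const (f := u) fun x _ => hM x
  have b2 : |∫ x in -A..t + -A, u x| ≤ M * |t + -A - -A| :=
    intervalIntegral.norm_integral_le_of_norm_le_const (f := u) fun x _ => hM x
  rw [add_sub_cancel_right] at b1 b2
  rw [abs_le] at *
  constructor <;> linarith [b1.1, b1.2, b2.1, b2.2]

/-- Since ∫ m = 0, u(t + ξ) may be replaced by u(t + ξ) - u(ξ). After Fubini the inner integral
tends to (b - a)t and is dominated by 2M|t|, so the finite first moment of m suffices. -/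
theorem tendsto_integral_convolution {u : ℝ → ℝ} {M a b : ℝ} (hu : Measurable u)
    (hM : ∀ x, |u x| ≤ M) (ha : Tendsto u atBot (𝓝 a)) (hb : Tendsto u atTop (𝓝 b))
    {m : ℝ → ℂ} (hm : Integrable m) (hm0 : ∫ t, m t = 0)
    (hm1 : Integrable fun t : ℝ => (t : ℂ) * m t) :
    Tendsto (fun A : ℝ => ∫ ξ in -A..A, ∫ t, (u (t + ξ) : ℂ) * m t) atTop
      (𝓝 ((b - a : ℝ) * ∫ t, ((t : ℝ) : ℂ) * m t)) := by
  have hii : ∀ (t A : ℝ), IntervalIntegrable (fun ξ => u (t + ξ)) volume (-A) A := fun t A => 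
      intervalIntegrable_of_bounded (hu.comp (measurable_const_add t)) (fun x => hM _) _ _
  have hM0 : 0 ≤ M := (abs_nonneg _).trans (hM 0)
  have hWm : ∀ A : ℝ, StronglyMeasurable fun t => ∫ ξ in -A..A, (u (t + ξ) - u ξ) := by
    intro A
    simp_rw [intervalIntegral.intervalIntegral_eq_integral_uIoc]
    refine StronglyMeasurable.const_smul (f := fun t => ∫ ξ in Set.uIoc (-A) A, (u (t + ξ) - u ξ))
      (StronglyMeasurable.integral_prod_right
        (f := fun t ξ => u (t + ξ) - u ξ) ?_) (if -A ≤ A then (1 : ℝ) else -1)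
    exact ((hu.comp (measurable_fst.add measurable_snd)).sub
      (hu.comp measurable_snd)).stronglyMeasurable
  have hWb : ∀ A t : ℝ, ‖((∫ ξ in -A..A, (u (t + ξ) - u ξ) : ℝ) : ℂ) * m t‖
      ≤ ‖((2 * M : ℝ) : ℂ) * (((t : ℝ) : ℂ) * m t)‖ := by
    intro A t
    rw [norm_mul, norm_mul, norm_mul, ← mul_assoc]
    gcongr
    simp only [Complex.norm_real, Real.norm_eq_abs]
    rw [abs_of_nonneg (by positivity : 0 ≤ 2 * M)]
    exact abs_integral_translates_le hu hM t A
  have hWi : ∀ A : ℝ, Integrable fun t =>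
      ((∫ ξ in -A..A, (u (t + ξ) - u ξ) : ℝ) : ℂ) * m t := fun A =>
    (hm1.const_mul ((2 * M : ℝ) : ℂ)).mono
      ((Complex.continuous_ofReal.comp_stronglyMeasurable (hWm A)).aestronglyMeasurable.mul hm.1)
      (ae_of_all _ fun t => hWb A t)
  have e : ∀ A : ℝ, ∫ ξ in -A..A, ∫ t, (u (t + ξ) : ℂ) * m t
      = ∫ t, ((∫ ξ in -A..A, (u (t + ξ) - u ξ) : ℝ) : ℂ) * m t := by
    intro A
    have hint : Integrable (Function.uncurry fun ξ t => (u (t + ξ) : ℂ) * m t)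
        ((volume.restrict (Set.uIoc (-A) A)).prod volume) := by
      have h0 : Integrable (fun p : ℝ × ℝ => (1 : ℂ) * m p.2)
          ((volume.restrict (Set.uIoc (-A) A)).prod volume) := by
        have hc : IntegrableOn (fun _ : ℝ => (1:ℂ)) (Set.uIoc (-A) A) volume :=
          integrableOn_const (by simp [Set.uIoc])
        exact hc.mul_prod hm
      refine (h0.const_mul (M : ℂ)).mono ?_ (ae_of_all _ fun p => ?_)
      · refine AEStronglyMeasurable.mul ?_ hm.1.comp_snd
        have : Measurable fun p : ℝ × ℝ => (u (p.2 + p.1) : ℂ) :=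
          Complex.measurable_ofReal.comp (hu.comp (measurable_snd.add measurable_fst))
        exact this.aestronglyMeasurable
      · simp only [Function.uncurry, norm_mul, Complex.norm_real, Real.norm_eq_abs, one_mul]
        exact mul_le_mul_of_nonneg_right ((hM _).trans (le_abs_self M)) (norm_nonneg _)
    rw [intervalIntegral_integral_swap hint]
    have hE : (∫ x, m x * ((∫ ξ in -A..A, u ξ : ℝ) : ℂ)) = 0 := by
      rw [integral_mul_const, hm0, zero_mul]
    have e1 : ∀ t, ∫ ξ in -A..A, (u (t + ξ) : ℂ) * m t
        = ((∫ ξ in -A..A, (u (t + ξ) - u ξ) : ℝ) : ℂ) * m t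
          + m t * ((∫ ξ in -A..A, u ξ : ℝ) : ℂ) := by
      intro t
      have h0 := hii 0 A
      simp only [zero_add] at h0
      rw [intervalIntegral.integral_mul_const, intervalIntegral.integral_sub (hii t A) h0,
        intervalIntegral.integral_ofReal]
      push_cast
      ring
    simp_rw [e1]
    rw [integral_add (hWi A) (hm.mul_const _), hE, add_zero]
  simp_rw [e]
  have hlim : (b - a : ℝ) * ∫ t, ((t : ℝ) : ℂ) * m t = ∫ t, (((b - a) * t : ℝ) : ℂ) * m t := by
    rw [← integral_const_mul]
    refine integral_congr_ae (ae_of_all _ fun t => ?_)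
    push_cast
    ring
  rw [hlim]
  refine tendsto_integral_filter_of_dominated_convergence
    (fun t : ℝ => ‖((2 * M : ℝ) : ℂ) * (((t : ℝ) : ℂ) * m t)‖) (Eventually.of_forall fun A => (hWi A).1)
    (Eventually.of_forall fun A => ae_of_all _ fun t => hWb A t) (hm1.const_mul _).norm
    (ae_of_all _ fun t => ?_)
  exact (((Complex.continuous_ofReal.tendsto _).comp
    (tendsto_integral_translates hu hM ha hb t))).mul_const _

/-! ### The local trace formula -/

theorem memLp_fourier {p : ℝ → ℂ} (p1 : Integrable p) (p2 : MemLp p 2 volume) :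
    MemLp (𝓕 p) 2 volume :=
  (memLp_congr_ae (FT_toLp_ae p1 p2)).1 (Lp.memLp _)

theorem integral_conj_fourier_mul_fourier {p q : ℝ → ℂ} (p1 : Integrable p)
    (p2 : MemLp p 2 volume) (q1 : Integrable q) (q2 : MemLp q 2 volume) :
    ∫ t, conj (𝓕 p t) * 𝓕 q t = ∫ x, conj (p x) * q x := by
  have h := FT.inner_map_map (p2.toLp p) (q2.toLp q)
  rw [L2.inner_def, L2.inner_def] at h
  refine Eq.trans (integral_congr_ae ?_) (h.trans (integral_congr_ae ?_))
  · filter_upwards [FT_toLp_ae p1 p2, FT_toLp_ae q1 q2] with x a b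
    rw [a, b]
    simp [mul_comm]
  · filter_upwards [p2.coeFn_toLp, q2.coeFn_toLp] with x a b
    rw [a, b]
    simp [mul_comm]

theorem integrable_conj_fourier_mul_fourier {p q : ℝ → ℂ} (p1 : Integrable p)
    (p2 : MemLp p 2 volume) (q1 : Integrable q) (q2 : MemLp q 2 volume) :
    Integrable fun t => conj (𝓕 p t) * 𝓕 q t :=
  MemLp.integrable_mul (memLp_fourier p1 p2).star (memLp_fourier q1 q2)

theorem memLp_ofReal_of_compactSupport {φ : ℝ → ℝ} (hφ : Continuous φ) (hs : HasCompactSupport φ)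
    (p : ℝ≥0∞) : MemLp (fun x => (φ x : ℂ)) p volume :=
  (Complex.continuous_ofReal.comp hφ).memLp_of_hasCompactSupport (hs.comp_left Complex.ofReal_zero)

theorem memLp_mul_of_bounded {g : ℝ → ℝ} (hg : Measurable g) (hgb : ∃ M, ∀ x, |g x| ≤ M)
    {φ : ℝ → ℂ} {p : ℝ≥0∞} (h : MemLp φ p volume) :
    MemLp (fun x => (g x : ℂ) * φ x) p volume := by
  obtain ⟨M, hM⟩ := hgb
  refine h.of_le_mul (c := M)
    ((Complex.measurable_ofReal.comp hg).aestronglyMeasurable.mul h.1) (ae_of_all _ fun x => ?_)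
  rw [norm_mul, Complex.norm_real]
  exact mul_le_mul_of_nonneg_right (hM x) (norm_nonneg _)

/-- The function m has integral zero because g is real, by Plancherel. Its first moment is also
found by Plancherel, from t·𝓕φ = c·𝓕φ' with c = 1/(2πi). The two terms add up because conj c = -c,
and i(b - a)(-2c) = -(b - a)/π. -/
theorem tendsto_integral_inner_modulate {f g : ℝ → ℝ} (hf : Measurable f)
    (hfb : ∃ M, ∀ x, |f x| ≤ M) (hg : Measurable g) (hgb : ∃ M, ∀ x, |g x| ≤ M) {a b : ℝ}
    (ha : Tendsto f atBot (𝓝 a)) (hb : Tendsto f atTop (𝓝 b)) {φ : ℝ → ℝ}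
    (hφ : ContDiff ℝ (⊤ : ℕ∞) φ) (hs : HasCompactSupport φ)
    (h2 : MemLp (fun x => (φ x : ℂ)) 2 volume) :
    Tendsto (fun A : ℝ => ∫ ξ in -A..A,
        inner ℂ (modulate h2 ξ) (commutator f g hf hfb hg hgb (modulate h2 ξ))) atTop
      (𝓝 ((-((b - a) / Real.pi) * ∫ x, g x * φ x * deriv φ x : ℝ) : ℂ)) := by
  have hpi := Real.pi_pos
  set φc : ℝ → ℂ := fun x => (φ x : ℂ) with hφc
  set b' : ℝ → ℂ := fun x => (g x : ℂ) * φc x with hb'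
  set dφ : ℝ → ℂ := fun x => ((deriv φ x : ℝ) : ℂ) with hdφ
  have h1 : Integrable φc :=
    memLp_one_iff_integrable.1 (memLp_ofReal_of_compactSupport hφ.continuous hs 1)
  have b2 : MemLp b' 2 volume := memLp_mul_of_bounded hg hgb h2
  have b1 : Integrable b' := memLp_one_iff_integrable.1
    (memLp_mul_of_bounded hg hgb (memLp_one_iff_integrable.2 h1))
  have hdc : Continuous (deriv φ) := hφ.continuous_deriv (by simp)
  have d2 : MemLp dφ 2 volume := memLp_ofReal_of_compactSupport hdc hs.deriv 2
  have d1 : Integrable dφ :=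
    memLp_one_iff_integrable.1 (memLp_ofReal_of_compactSupport hdc hs.deriv 1)
  have hder : deriv φc = dφ := by
    funext x
    exact ((hφ.differentiable (by simp) x).hasDerivAt.ofReal_comp).deriv
  have hdiff : Differentiable ℝ φc := fun x =>
    ((hφ.differentiable (by simp) x).hasDerivAt.ofReal_comp).differentiableAt
  have hF : ∀ t : ℝ, 𝓕 dφ t = (2 * Real.pi * Complex.I * t) * 𝓕 φc t := by
    intro t
    rw [← hder, Real.fourier_deriv h1 hdiff (hder ▸ d1)]
    simp
  set m : ℝ → ℂ := fun t => conj (𝓕 φc t) * 𝓕 b' t - conj (𝓕 b' t) * 𝓕 φc t with hm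
  set c : ℂ := (2 * Real.pi * Complex.I)⁻¹ with hc
  have hc0 : (2 * Real.pi * Complex.I : ℂ) ≠ 0 := by
    simp [hpi.ne']
  have htF : ∀ t : ℝ, (t : ℂ) * 𝓕 φc t = c * 𝓕 dφ t := by
    intro t
    rw [hF, hc]
    field_simp
  have hcc : conj c = -c := by
    rw [hc, map_inv₀, map_mul, map_mul, Complex.conj_I, Complex.conj_ofReal, ← inv_neg]
    congr 1
    simp [Complex.conj_ofNat]
  -- The factor t is always absorbed by the transform of φ, never by that of gφ, so g need not be
  -- differentiable.
  have htm : ∀ t : ℝ, (t : ℂ) * m t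
      = -c * (conj (𝓕 dφ t) * 𝓕 b' t) - c * (conj (𝓕 b' t) * 𝓕 dφ t) := by
    intro t
    have h3 : (t : ℂ) * conj (𝓕 φc t) = - c * conj (𝓕 dφ t) := by
      have := congrArg conj (htF t)
      rwa [map_mul, map_mul, hcc, Complex.conj_ofReal] at this
    calc (t : ℂ) * m t = ((t : ℂ) * conj (𝓕 φc t)) * 𝓕 b' t
          - conj (𝓕 b' t) * ((t : ℂ) * 𝓕 φc t) := by rw [hm]; ring
      _ = _ := by rw [h3, htF]; ring
  have I1 := integrable_conj_fourier_mul_fourier h1 h2 b1 b2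
  have I2 := integrable_conj_fourier_mul_fourier b1 b2 h1 h2
  have I3 := integrable_conj_fourier_mul_fourier d1 d2 b1 b2
  have I4 := integrable_conj_fourier_mul_fourier b1 b2 d1 d2
  have hmi : Integrable m := I1.sub I2
  have hm0 : ∫ t, m t = 0 := by
    rw [hm, integral_sub I1 I2, integral_conj_fourier_mul_fourier h1 h2 b1 b2,
      integral_conj_fourier_mul_fourier b1 b2 h1 h2, sub_eq_zero]
    refine integral_congr_ae (ae_of_all _ fun x => ?_)
    simp only [hb', hφc, map_mul, Complex.conj_ofReal]
    ring
  have hm1 : Integrable fun t : ℝ => (t : ℂ) * m t := by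
    simp_rw [htm]
    exact (I3.const_mul _).sub (I4.const_mul _)
  have hmint : ∫ t : ℝ, (t : ℂ) * m t
      = -(2 * c) * ((∫ x, g x * φ x * deriv φ x : ℝ) : ℂ) := by
    simp_rw [htm]
    rw [integral_sub (I3.const_mul _) (I4.const_mul _), integral_const_mul, integral_const_mul,
      integral_conj_fourier_mul_fourier d1 d2 b1 b2, integral_conj_fourier_mul_fourier b1 b2 d1 d2]
    have e0 : ((∫ x, g x * φ x * deriv φ x : ℝ) : ℂ)
        = ∫ x, ((g x * φ x * deriv φ x : ℝ) : ℂ) := integral_ofReal.symm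
    have e1 : ∫ x, conj (dφ x) * b' x = ∫ x, ((g x * φ x * deriv φ x : ℝ) : ℂ) := by
      refine integral_congr_ae (ae_of_all _ fun x => ?_)
      simp only [hdφ, hb', hφc, Complex.conj_ofReal]
      push_cast; ring
    have e2 : ∫ x, conj (b' x) * dφ x = ∫ x, ((g x * φ x * deriv φ x : ℝ) : ℂ) := by
      refine integral_congr_ae (ae_of_all _ fun x => ?_)
      simp only [hdφ, hb', hφc, map_mul, Complex.conj_ofReal]
      push_cast; ring
    rw [e0, e1, e2]
    ring
  obtain ⟨M, hM⟩ := hfb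
  have hscale : Tendsto (fun t : ℝ => 2 * Real.pi * t) atTop atTop :=
    tendsto_id.const_mul_atTop (by positivity)
  have hscale' : Tendsto (fun t : ℝ => 2 * Real.pi * t) atBot atBot :=
    tendsto_id.const_mul_atBot (by positivity)
  have key := tendsto_integral_convolution (u := fun t => f (2 * Real.pi * t))
    (hf.comp (measurable_const_mul _)) (fun x => hM _) (ha.comp hscale') (hb.comp hscale)
    hmi hm0 hm1
  have key2 := key.const_mul Complex.I
  refine (key2.congr fun A => ?_).trans (le_of_eq ?_)
  · rw [← intervalIntegral.integral_const_mul]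
    refine intervalIntegral.integral_congr fun ξ _ => ?_
    exact (inner_commutator_modulate hf ⟨M, hM⟩ hg hgb h1 h2 b1 b2 ξ).symm
  · rw [hmint, hc]
    congr 1
    push_cast
    field_simp

/-- Positivity of C makes the integrand nonnegative, so convergence of the integrals over [-A, A]
already gives integrability and identifies the integral over ℝ. -/
theorem lintegral_inner_commutator_modulate {f g : ℝ → ℝ} (hf : Measurable f)
    (hfb : ∃ M, ∀ x, |f x| ≤ M) (hg : Measurable g) (hgb : ∃ M, ∀ x, |g x| ≤ M) {a b : ℝ}
    (ha : Tendsto f atBot (𝓝 a)) (hb : Tendsto f atTop (𝓝 b))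
    (hC : (commutator f g hf hfb hg hgb).IsPositive) {φ : ℝ → ℝ}
    (hφ : ContDiff ℝ (⊤ : ℕ∞) φ) (hs : HasCompactSupport φ)
    (h2 : MemLp (fun x => (φ x : ℂ)) 2 volume) :
    0 ≤ -((b - a) / Real.pi) * ∫ x, g x * φ x * deriv φ x ∧
    ∫⁻ ξ, ENNReal.ofReal
      (inner ℂ (modulate h2 ξ) (commutator f g hf hfb hg hgb (modulate h2 ξ))).re =
      ENNReal.ofReal (-((b - a) / Real.pi) * ∫ x, g x * φ x * deriv φ x) := by
  set q : ℝ → ℂ := fun ξ =>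
    inner ℂ (modulate h2 ξ) (commutator f g hf hfb hg hgb (modulate h2 ξ)) with hq
  set L : ℝ := -((b - a) / Real.pi) * ∫ x, g x * φ x * deriv φ x
  have h1 : Integrable fun x => (φ x : ℂ) :=
    memLp_one_iff_integrable.1 (memLp_ofReal_of_compactSupport hφ.continuous hs 1)
  have hqm : StronglyMeasurable q := by
    have e : q = fun ξ => _ := funext fun ξ => inner_commutator_modulate hf hfb hg hgb h1 h2
      (memLp_one_iff_integrable.1 (memLp_mul_of_bounded hg hgb (memLp_one_iff_integrable.2 h1)))
      (memLp_mul_of_bounded hg hgb h2) ξ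
    rw [e]
    have hcont : ∀ {p : ℝ → ℂ}, Integrable p → Continuous (𝓕 p) := fun hp =>
      VectorFourier.fourierIntegral_continuous Real.continuous_fourierChar
        (by exact continuous_inner) hp
    have c1 := hcont h1
    have c2 := hcont
      (memLp_one_iff_integrable.1 (memLp_mul_of_bounded hg hgb (memLp_one_iff_integrable.2 h1)))
    refine (StronglyMeasurable.integral_prod_right (f := fun ξ t =>
      (f (2 * Real.pi * (t + ξ)) : ℂ) * (conj (𝓕 (fun x => (φ x : ℂ)) t) *
        𝓕 (fun x => (g x : ℂ) * (φ x : ℂ)) t - conj (𝓕 (fun x => (g x : ℂ) * (φ x : ℂ)) t) *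
          𝓕 (fun x => (φ x : ℂ)) t)) ?_).const_mul _
    refine (Measurable.mul ?_ ?_).stronglyMeasurable
    · exact Complex.measurable_ofReal.comp (hf.comp ((measurable_snd.add measurable_fst).const_mul _))
    · have : Continuous fun t => (conj (𝓕 (fun x => (φ x : ℂ)) t) *
        𝓕 (fun x => (g x : ℂ) * (φ x : ℂ)) t - conj (𝓕 (fun x => (g x : ℂ) * (φ x : ℂ)) t) *
          𝓕 (fun x => (φ x : ℂ)) t) :=
        ((Complex.continuous_conj.comp c1).mul c2).sub ((Complex.continuous_conj.comp c2).mul c1)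
      exact this.measurable.comp measurable_snd
  have hqb : ∀ ξ, ‖q ξ‖ ≤ ‖commutator f g hf hfb hg hgb‖ * ‖h2.toLp _‖ ^ 2 := by
    intro ξ
    refine (norm_inner_le_norm _ _).trans ?_
    have := (commutator f g hf hfb hg hgb).le_opNorm (modulate h2 ξ)
    rw [norm_modulate] at *
    nlinarith [norm_nonneg (h2.toLp (fun x => (φ x : ℂ)))]
  have hq0 : ∀ ξ, 0 ≤ (q ξ).re := fun ξ => hC.re_inner_nonneg_right _
  have hrm : Measurable fun ξ => (q ξ).re := Complex.measurable_re.comp hqm.measurable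
  have hri : ∀ c d, IntervalIntegrable (fun ξ => (q ξ).re) volume c d :=
    intervalIntegrable_of_bounded hrm fun ξ => (Complex.abs_re_le_norm _).trans (hqb ξ)
  have hqi : ∀ c d, IntervalIntegrable q volume c d := fun c d =>
    (intervalIntegrable_const (c := ‖commutator f g hf hfb hg hgb‖ * ‖h2.toLp _‖ ^ 2)).mono_fun
      hqm.aestronglyMeasurable (ae_of_all _ fun ξ => (hqb ξ).trans (le_abs_self _))
  have key := tendsto_integral_inner_modulate hf hfb hg hgb ha hb hφ hs h2
  have key2 : Tendsto (fun A : ℝ => ∫ ξ in -A..A, (q ξ).re) atTop (𝓝 L) := by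
    have := (Complex.continuous_re.tendsto _).comp key
    refine this.congr fun A => ?_
    exact (Complex.reCLM.intervalIntegral_comp_comm (hqi _ _)).symm
  have hint : Integrable fun ξ => (q ξ).re := by
    refine integrable_of_intervalIntegral_norm_tendsto (l := atTop) (a := fun A => -A)
      (b := fun A => A) L (fun A => (hri (-A) A).1) tendsto_neg_atTop_atBot tendsto_id ?_
    simpa only [Real.norm_eq_abs, abs_of_nonneg (hq0 _)] using key2
  have hL := tendsto_nhds_unique key2
    (intervalIntegral_tendsto_integral hint tendsto_neg_atTop_atBot tendsto_id)
  rw [hL, ofReal_integral_eq_lintegral_ofReal hint (ae_of_all _ hq0)]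
  exact ⟨integral_nonneg hq0, rfl⟩

/-! ### The diagonal density of a positive operator -/

theorem tsum_enorm_sq_inner {ι : Type*} (e : HilbertBasis ι ℂ L2) (v : L2) :
    ∑' i, ‖inner ℂ (e i) v‖ₑ ^ 2 = ‖v‖ₑ ^ 2 := by
  have h := e.hasSum_inner_mul_inner v v
  have h2 : HasSum (fun i => ‖inner ℂ (e i) v‖ ^ 2) (‖v‖ ^ 2) := by
    have := Complex.hasSum_re h
    rw [show (inner ℂ v v).re = ‖v‖ ^ 2 from inner_self_eq_norm_sq (𝕜 := ℂ) v] at this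
    convert this using 1
    funext i
    rw [← inner_conj_symm v (e i), mul_comm, Complex.mul_conj, Complex.normSq_eq_norm_sq,
      Complex.ofReal_re]
  have e3 : ∀ z : ℂ, ‖z‖ₑ ^ 2 = ENNReal.ofReal (‖z‖ ^ 2) := fun z => by
    rw [ENNReal.ofReal_pow (norm_nonneg _), ofReal_norm]
  simp_rw [e3]
  rw [← ENNReal.ofReal_tsum_of_nonneg (fun i => by positivity) h2.summable, h2.tsum_eq,
    ENNReal.ofReal_pow (norm_nonneg _), ofReal_norm]

/-- The density `∑ᵢ |S eᵢ|²` of an operator with respect to a family of vectors. -/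
def density {ι : Type*} (S : L2 →L[ℂ] L2) (e : ι → L2) (x : ℝ) : ℝ≥0∞ := ∑' i, ‖S (e i) x‖ₑ ^ 2

/-- Apply Plancherel in ξ to each (S eᵢ, φ_ξ) = (eᵢ, S φ_ξ), then Parseval in i: the sum is ‖S φ_ξ‖²
= (φ_ξ, C φ_ξ). All terms are nonnegative, so sums and integrals may be exchanged before anything is
known to be finite. -/
theorem lintegral_density_mul {ι : Type*} [Countable ι] (C S : L2 →L[ℂ] L2)
    (hS : S.IsPositive) (hSC : S * S = C) (e : HilbertBasis ι ℂ L2) {φ : ℝ → ℂ}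
    (h2 : MemLp φ 2 volume) (hb : MemLp φ ∞ volume) :
    ∫⁻ x, density S e x * ‖φ x‖ₑ ^ 2 =
      ∫⁻ ξ, ENNReal.ofReal (inner ℂ (modulate h2 ξ) (C (modulate h2 ξ))).re := by
  have hsymm : ∀ a b : L2, inner ℂ (S a) b = inner ℂ a (S b) := fun a b => hS.isSymmetric a b
  have hm : ∀ i, AEMeasurable (fun x => ‖S (e i) x‖ₑ ^ 2 * ‖φ x‖ₑ ^ 2) volume := fun i =>
    ((Lp.aestronglyMeasurable _).enorm.pow_const 2).mul (h2.1.enorm.pow_const 2)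
  simp_rw [density, ← ENNReal.tsum_mul_right]
  rw [lintegral_tsum hm]
  simp_rw [← lintegral_inner_modulate _ h2 hb]
  rw [← lintegral_tsum fun i =>
    ((continuous_inner_modulate _ h2).enorm.measurable.pow_const 2).aemeasurable]
  refine lintegral_congr fun ξ => ?_
  simp_rw [hsymm]
  rw [tsum_enorm_sq_inner, ← hSC, mul_apply_eq_comp, ← hsymm,
    ← ofReal_norm, ← ENNReal.ofReal_pow (norm_nonneg _)]
  congr 1
  exact (inner_self_eq_norm_sq (𝕜 := ℂ) _).symm

/-! ### Functions determined by their distributional derivative -/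

theorem exists_support_subset_Ioc {φ : ℝ → ℝ} (hs : HasCompactSupport φ) :
    ∃ R : ℝ, 0 < R ∧ tsupport φ ⊆ Set.Ioo (-R) R := by
  obtain ⟨r, hr⟩ := hs.isBounded.subset_ball (0 : ℝ)
  refine ⟨max r 1, by positivity, hr.trans fun x hx => ?_⟩
  rw [Metric.mem_ball, Real.dist_eq, sub_zero, abs_lt] at hx
  exact ⟨by linarith [le_max_left r 1], lt_of_lt_of_le hx.2 (le_max_left _ _)⟩

theorem exists_smooth_one_on_tsupport {φ : ℝ → ℝ} (hs : HasCompactSupport φ) :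
    ∃ ψ : ℝ → ℝ, ContDiff ℝ (⊤ : ℕ∞) ψ ∧ HasCompactSupport ψ ∧ (∀ x, 0 ≤ ψ x) ∧
      ∀ x, φ x * ψ x = φ x := by
  obtain ⟨R, hR, hsub⟩ := exists_support_subset_Ioc hs
  let β : ContDiffBump (0 : ℝ) := ⟨R, R + 1, hR, by linarith⟩
  refine ⟨β, β.contDiff, β.hasCompactSupport, fun x => β.nonneg, fun x => ?_⟩
  by_cases hx : x ∈ tsupport φ
  · have := hsub hx
    have h1 : β x = 1 := β.one_of_mem_closedBall (by
      rw [Metric.mem_closedBall, Real.dist_eq, sub_zero, abs_le]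
      exact ⟨this.1.le, this.2.le⟩)
    rw [h1, mul_one]
  · rw [image_eq_zero_of_notMem_tsupport hx, zero_mul]

/-- The du Bois-Reymond lemma. -/
theorem ae_eq_const_of_integral_mul_deriv_eq_zero {N : ℝ → ℝ} (hN : LocallyIntegrable N)
    (h : ∀ φ : ℝ → ℝ, ContDiff ℝ (⊤ : ℕ∞) φ → HasCompactSupport φ → ∫ x, N x * deriv φ x = 0) :
    ∃ c, N =ᵐ[volume] fun _ => c := by
  let β : ContDiffBump (0 : ℝ) := ⟨1, 2, one_pos, by norm_num⟩
  set ρ : ℝ → ℝ := β.normed volume with hρ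
  have hρc : ContDiff ℝ (⊤ : ℕ∞) ρ := β.contDiff_normed
  have hρs : HasCompactSupport ρ := β.hasCompactSupport_normed
  have hρ1 : ∫ x, ρ x = 1 := β.integral_normed
  refine ⟨∫ x, N x * ρ x, ae_eq_of_integral_contDiff_smul_eq hN (locallyIntegrable_const _)
    fun η hη hηs => ?_⟩
  set I : ℝ := ∫ x, η x with hI
  have hηi : Integrable η := hη.continuous.integrable_of_hasCompactSupport hηs
  have hρi : Integrable ρ := hρc.continuous.integrable_of_hasCompactSupport hρs
  -- Subtracting Iρ makes the integral zero, which is exactly the condition for a compactly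
  -- supported primitive.
  set ζ : ℝ → ℝ := fun x => η x - I * ρ x with hζ
  have hζc : ContDiff ℝ (⊤ : ℕ∞) ζ := hη.sub (contDiff_const.mul hρc)
  have hζs : HasCompactSupport ζ := hηs.sub (hρs.mul_left (f := fun _ => I))
  have hζ0 : ∫ x, ζ x = 0 := by
    rw [hζ, integral_sub hηi (hρi.const_mul _), integral_const_mul, hρ1, mul_one, sub_self]
  obtain ⟨R, hR, hsub⟩ := exists_support_subset_Ioc hζs
  have hz : ∀ x, x ∉ Set.Ioo (-R) R → ζ x = 0 := fun x hx =>
    image_eq_zero_of_notMem_tsupport fun hx' => hx (hsub hx')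
  have hii : ∀ a b, IntervalIntegrable ζ volume a b := fun a b =>
    hζc.continuous.intervalIntegrable _ _
  set φ : ℝ → ℝ := fun x => ∫ t in (-R)..x, ζ t with hφ
  have hφd : ∀ x, HasDerivAt φ (ζ x) x := fun x =>
    intervalIntegral.integral_hasDerivAt_right (hii _ _)
      hζc.continuous.stronglyMeasurable.stronglyMeasurableAtFilter hζc.continuous.continuousAt
  have hφder : deriv φ = ζ := funext fun x => (hφd x).deriv
  have hφc : ContDiff ℝ (⊤ : ℕ∞) φ := by
    rw [contDiff_infty_iff_deriv]
    exact ⟨fun x => (hφd x).differentiableAt, hφder ▸ hζc⟩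
  have hφs : HasCompactSupport φ := by
    refine HasCompactSupport.intro (isCompact_Icc (a := -R) (b := R)) fun x hx => ?_
    rcases lt_or_ge x (-R) with h1 | h1
    · rw [hφ]
      refine (intervalIntegral.integral_congr fun t ht => ?_).trans intervalIntegral.integral_zero
      rw [Set.uIcc_of_ge h1.le] at ht
      exact hz t fun h' => by linarith [h'.1, ht.2]
    · have h2 : R < x := by
        by_contra h3
        exact hx ⟨h1, not_lt.1 h3⟩
      rw [← hζ0]
      refine intervalIntegral.integral_eq_integral_of_support_subset fun t ht => ?_
      by_contra h3
      exact ht (hz t fun h' => h3 ⟨h'.1, by linarith [h'.2]⟩)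
  have key := h φ hφc hφs
  rw [hφder] at key
  have i1 : Integrable fun x => N x * η x :=
    hN.integrable_smul_right_of_hasCompactSupport hη.continuous hηs
  have i2 : Integrable fun x => N x * ρ x :=
    hN.integrable_smul_right_of_hasCompactSupport hρc.continuous hρs
  have e : ∀ x, N x * ζ x = N x * η x - I * (N x * ρ x) := fun x => by rw [hζ]; ring
  simp_rw [e] at key
  rw [integral_sub i1 (i2.const_mul _), integral_const_mul, sub_eq_zero] at key
  simp only [smul_eq_mul]
  rw [integral_mul_const, ← hI, ← key]
  exact integral_congr_ae (ae_of_all _ fun x => mul_comm _ _)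

theorem integral_mul_eq_neg_integral_primitive {w φ : ℝ → ℝ} (hw : LocallyIntegrable w)
    (hφ : ContDiff ℝ (⊤ : ℕ∞) φ) (hs : HasCompactSupport φ) :
    ∫ x, φ x * w x = - ∫ x, (∫ t in (0:ℝ)..x, w t) * deriv φ x := by
  obtain ⟨R, hR, hsub⟩ := exists_support_subset_Ioc hs
  have hii : ∀ a b, IntervalIntegrable w volume a b := fun a b =>
    (hw.integrableOn_isCompact isCompact_uIcc).intervalIntegrable
  have hz : ∀ x, x ∉ Set.Ioo (-R) R → φ x = 0 := fun x hx =>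
    image_eq_zero_of_notMem_tsupport fun hx' => hx (hsub hx')
  have hz' : ∀ x, x ∉ Set.Ioo (-R) R → deriv φ x = 0 := fun x hx =>
    image_eq_zero_of_notMem_tsupport fun hx' => hx (hsub (tsupport_deriv_subset hx'))
  set W : ℝ → ℝ := fun x => ∫ t in (0:ℝ)..x, w t with hW
  have ac1 : AbsolutelyContinuousOnInterval W (-R) R :=
    (hii (-R) R).absolutelyContinuousOnInterval_intervalIntegral (c := 0) (by
      rw [Set.uIcc_of_le (by linarith)]; constructor <;> linarith)
  have ac2 : AbsolutelyContinuousOnInterval φ (-R) R :=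
    ((hφ.of_le (by simp) : ContDiff ℝ 1 φ).contDiffOn).absolutelyContinuousOnInterval
  have := ac1.integral_mul_deriv_eq_deriv_mul ac2
  rw [hz R (by simp), hz (-R) (by simp)] at this
  have e1 : ∫ x, W x * deriv φ x = ∫ x in (-R)..R, W x * deriv φ x := by
    refine (intervalIntegral.integral_eq_integral_of_support_subset fun t ht => ?_).symm
    by_contra h3
    exact ht (by simp only; rw [hz' t fun h' => h3 ⟨h'.1, h'.2.le⟩, mul_zero])
  have e2 : ∫ x, φ x * w x = ∫ x in (-R)..R, deriv W x * φ x := by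
    rw [← intervalIntegral.integral_eq_integral_of_support_subset (a := -R) (b := R)]
    · refine intervalIntegral.integral_congr_ae ?_
      filter_upwards [_root_.LocallyIntegrable.ae_hasDerivAt_integral hw] with x hx _
      rw [(hx 0).deriv, mul_comm]
    · intro t ht
      by_contra h3
      exact ht (by simp only; rw [hz t fun h' => h3 ⟨h'.1, h'.2.le⟩, zero_mul])
  rw [e1, e2, this]
  ring

/-- The hypothesis says D = κ g' as distributions, tested on squares only, since 2φφ' = (φ²)'.
Cut-offs equal to 1 on large balls show that D is locally integrable; polarization recovers all test
functions; then the du Bois-Reymond lemma applies to the primitive of D minus κg. -/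
theorem exists_ae_eq_primitive {D : ℝ → ℝ≥0∞} (hD : AEMeasurable D) {g : ℝ → ℝ}
    (hg : LocallyIntegrable g) {κ : ℝ}
    (h : ∀ φ : ℝ → ℝ, ContDiff ℝ (⊤ : ℕ∞) φ → HasCompactSupport φ →
      0 ≤ -(2 * κ) * ∫ x, g x * φ x * deriv φ x ∧
      ∫⁻ x, D x * ‖(φ x : ℂ)‖ₑ ^ 2 = ENNReal.ofReal (-(2 * κ) * ∫ x, g x * φ x * deriv φ x)) :
    (∀ᵐ x, D x < ∞) ∧ LocallyIntegrable (fun x => (D x).toReal) ∧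
      ∃ c, ∀ᵐ x, (∫ t in (0:ℝ)..x, (D t).toReal) - κ * g x = c := by
  let β : ℕ → ContDiffBump (0 : ℝ) := fun n => ⟨(n : ℝ) + 1, (n : ℝ) + 2, by positivity, by linarith⟩
  have hβ1 : ∀ (n : ℕ) (x : ℝ), |x| ≤ (n : ℝ) + 1 → β n x = 1 := fun n x hx =>
    (β n).one_of_mem_closedBall (by rw [Metric.mem_closedBall, Real.dist_eq, sub_zero]; exact hx)
  have hfin : ∀ n, ∫⁻ x, D x * ‖((β n x : ℝ) : ℂ)‖ₑ ^ 2 ≠ ∞ := fun n => by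
    rw [(h (β n) (β n).contDiff (β n).hasCompactSupport).2]
    exact ENNReal.ofReal_ne_top
  have hDm : ∀ φ : ℝ → ℝ, Continuous φ → AEMeasurable fun x => D x * ‖(φ x : ℂ)‖ₑ ^ 2 :=
    fun φ hφ => hD.mul
      ((Complex.continuous_ofReal.comp hφ).enorm.measurable.pow_const 2).aemeasurable
  have hlt : ∀ᵐ x, D x < ∞ := by
    have : ∀ᵐ x, ∀ n, D x * ‖((β n x : ℝ) : ℂ)‖ₑ ^ 2 < ∞ :=
      ae_all_iff.2 fun n => ae_lt_top' (hDm _ (β n).continuous) (hfin n)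
    filter_upwards [this] with x hx
    obtain ⟨n, hn⟩ := exists_nat_ge |x|
    have h1 := hx n
    rw [hβ1 n x (by linarith)] at h1
    simpa using h1
  have hloc : LocallyIntegrable (fun x => (D x).toReal) := by
    rw [locallyIntegrable_iff]
    intro K hK
    obtain ⟨R, hR⟩ := hK.isBounded.subset_closedBall (0 : ℝ)
    obtain ⟨n, hn⟩ := exists_nat_ge R
    refine IntegrableOn.mono_set ?_ hR
    refine integrable_toReal_of_lintegral_ne_top hD.restrict (ne_top_of_le_ne_top (hfin n) ?_)
    rw [← lintegral_indicator measurableSet_closedBall]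
    refine lintegral_mono fun x => Set.indicator_apply_le' (fun hx => ?_) fun _ => zero_le
    rw [Metric.mem_closedBall, Real.dist_eq, sub_zero] at hx
    rw [hβ1 n x (by linarith)]
    simp
  refine ⟨hlt, hloc, ?_⟩
  set w : ℝ → ℝ := fun x => (D x).toReal with hw
  have hsq : ∀ φ : ℝ → ℝ, ContDiff ℝ (⊤ : ℕ∞) φ → HasCompactSupport φ →
      ∫ x, φ x * φ x * w x = -(2 * κ) * ∫ x, g x * φ x * deriv φ x := by
    intro φ hφ hs
    obtain ⟨h1, h2⟩ := h φ hφ hs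
    have hi : AEStronglyMeasurable (fun x => φ x * φ x * w x) volume :=
      ((hφ.continuous.mul hφ.continuous).aestronglyMeasurable).mul
        hD.ennreal_toReal.aestronglyMeasurable
    rw [integral_eq_lintegral_of_nonneg_ae (ae_of_all _ fun x =>
      mul_nonneg (mul_self_nonneg _) ENNReal.toReal_nonneg) hi, ← ENNReal.toReal_ofReal h1, ← h2]
    congr 1
    refine lintegral_congr_ae ?_
    filter_upwards [hlt] with x hx
    rw [ENNReal.ofReal_mul (mul_self_nonneg _), ENNReal.ofReal_toReal hx.ne, mul_comm]
    congr 1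
    rw [← ofReal_norm, ← ENNReal.ofReal_pow (norm_nonneg _), Complex.norm_real, Real.norm_eq_abs,
      sq_abs, sq]
  have hlin : ∀ φ : ℝ → ℝ, ContDiff ℝ (⊤ : ℕ∞) φ → HasCompactSupport φ →
      ∫ x, φ x * w x = -κ * ∫ x, g x * deriv φ x := by
    intro φ hφ hs
    -- With ψ = 1 on the support of φ one has 4φ = (φ + ψ)² - (φ - ψ)², which turns the identity for
    -- squares into one that is linear in φ.
    obtain ⟨ψ, hψ, hψs, -, h1⟩ := exists_smooth_one_on_tsupport hs
    have dφ : ∀ x, HasDerivAt φ (deriv φ x) x := fun x =>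
      (hφ.differentiable (by simp) x).hasDerivAt
    have dψ : ∀ x, HasDerivAt ψ (deriv ψ x) x := fun x =>
      (hψ.differentiable (by simp) x).hasDerivAt
    have hder : ∀ x, deriv φ x = deriv φ x * ψ x + φ x * deriv ψ x := by
      intro x
      have h2 : HasDerivAt (fun x => φ x * ψ x) (deriv φ x * ψ x + φ x * deriv ψ x) x :=
        (dφ x).mul (dψ x)
      simp_rw [h1] at h2
      exact h2.deriv
    have p1 := hsq (fun x => φ x + ψ x) (hφ.add hψ) (hs.add hψs)
    have p2 := hsq (fun x => φ x - ψ x) (hφ.sub hψ) (hs.sub hψs)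
    have d1 : ∀ x, deriv (fun x => φ x + ψ x) x = deriv φ x + deriv ψ x := fun x =>
      ((dφ x).add (dψ x)).deriv
    have d2 : ∀ x, deriv (fun x => φ x - ψ x) x = deriv φ x - deriv ψ x := fun x =>
      ((dφ x).sub (dψ x)).deriv
    have cφ := hφ.continuous_deriv (by simp)
    have cψ := hψ.continuous_deriv (by simp)
    have iw : ∀ {χ : ℝ → ℝ}, Continuous χ → HasCompactSupport χ →
        Integrable fun x => χ x * w x := fun hc hs =>
      hloc.integrable_smul_left_of_hasCompactSupport hc hs
    have ig : ∀ {χ : ℝ → ℝ}, Continuous χ → HasCompactSupport χ →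
        Integrable fun x => g x * χ x := fun hc hs =>
      hg.integrable_smul_right_of_hasCompactSupport hc hs
    have sa := hs.add hψs
    have sb := hs.sub hψs
    have l1 : ∫ x, φ x * w x = (1 / 4) * ((∫ x, (φ x + ψ x) * (φ x + ψ x) * w x)
        - ∫ x, (φ x - ψ x) * (φ x - ψ x) * w x) := by
      have j1 : Integrable fun x => (φ x + ψ x) * (φ x + ψ x) * w x :=
        iw ((hφ.continuous.add hψ.continuous).mul (hφ.continuous.add hψ.continuous)) sa.mul_left
      have j2 : Integrable fun x => (φ x - ψ x) * (φ x - ψ x) * w x :=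
        iw ((hφ.continuous.sub hψ.continuous).mul (hφ.continuous.sub hψ.continuous)) sb.mul_left
      rw [← integral_sub j1 j2, ← integral_const_mul]
      refine integral_congr_ae (ae_of_all _ fun x => ?_)
      linear_combination (-w x) * h1 x
    have l2 : ∫ x, g x * deriv φ x = (1 / 2) * ((∫ x, g x * (φ x + ψ x) * (deriv φ x + deriv ψ x))
        - ∫ x, g x * (φ x - ψ x) * (deriv φ x - deriv ψ x)) := by
      simp_rw [mul_assoc]
      have j1 : Integrable fun x => g x * ((φ x + ψ x) * (deriv φ x + deriv ψ x)) :=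
        ig ((hφ.continuous.add hψ.continuous).mul (cφ.add cψ)) sa.mul_right
      have j2 : Integrable fun x => g x * ((φ x - ψ x) * (deriv φ x - deriv ψ x)) :=
        ig ((hφ.continuous.sub hψ.continuous).mul (cφ.sub cψ)) sb.mul_right
      rw [← integral_sub j1 j2, ← integral_const_mul]
      refine integral_congr_ae (ae_of_all _ fun x => ?_)
      linear_combination (g x) * hder x
    simp_rw [d1] at p1
    simp_rw [d2] at p2
    rw [l1, l2, p1, p2]
    ring
  have hWc : Continuous fun x => ∫ t in (0:ℝ)..x, w t :=
    intervalIntegral.continuous_primitive (fun a b =>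
      (hloc.integrableOn_isCompact isCompact_uIcc).intervalIntegrable) 0
  refine ae_eq_const_of_integral_mul_deriv_eq_zero
    (hWc.locallyIntegrable.sub (hg.smul κ)) fun φ hφ hs => ?_
  have cφ := hφ.continuous_deriv (by simp)
  have e1 := integral_mul_eq_neg_integral_primitive hloc hφ hs
  have i1 : Integrable fun x => (∫ t in (0:ℝ)..x, w t) * deriv φ x :=
    hWc.locallyIntegrable.integrable_smul_right_of_hasCompactSupport cφ hs.deriv
  have i2 : Integrable fun x => g x * deriv φ x :=
    hg.integrable_smul_right_of_hasCompactSupport cφ hs.deriv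
  have e2 : ∀ x, ((∫ t in (0:ℝ)..x, w t) - κ * g x) * deriv φ x
      = (∫ t in (0:ℝ)..x, w t) * deriv φ x - κ * (g x * deriv φ x) := fun x => by ring
  refine (integral_congr_ae (ae_of_all _ e2)).trans ?_
  rw [integral_sub i1 (i2.const_mul κ), integral_const_mul]
  rw [hlin φ hφ hs] at e1
  linarith

/-! ### Absolute continuity and the trace -/

/-- L² is separable and distinct basis vectors are at distance √2, so the balls of radius 1/2 are
disjoint. -/
theorem countable_of_hilbertBasis {ι : Type*} (e : HilbertBasis ι ℂ L2) : Countable ι := by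
  have : Fact ((2 : ℝ≥0∞) ≠ ∞) := ⟨by norm_num⟩
  refine Pairwise.countable_of_isOpen_disjoint (s := fun i => Metric.ball (e i) (1 / 2))
    (fun i j hij => ?_) (fun i => Metric.isOpen_ball)
    (fun i => ⟨e i, Metric.mem_ball_self (by norm_num)⟩)
  refine Metric.ball_disjoint_ball ?_
  rw [dist_eq_norm]
  have h0 : inner ℂ (e i) (e j) = 0 := e.orthonormal.2 hij
  have h := norm_sub_sq (𝕜 := ℂ) (e i) (e j)
  rw [h0, e.orthonormal.1 i, e.orthonormal.1 j] at h
  norm_num at h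
  nlinarith [norm_nonneg (e i - e j)]

theorem measurable_density {ι : Type*} [Countable ι] (S : L2 →L[ℂ] L2) (e : ι → L2) :
    Measurable (density S e) := by
  unfold density
  exact Measurable.tsum fun i => (Lp.stronglyMeasurable _).measurable.enorm.pow_const 2

theorem exists_sqrt {H : Type*} [NormedAddCommGroup H] [InnerProductSpace ℂ H] [CompleteSpace H]
    {C : H →L[ℂ] H} (hC : C.IsPositive) : ∃ S : H →L[ℂ] H, S.IsPositive ∧ S * S = C := by
  have h0 : 0 ≤ C := (ContinuousLinearMap.nonneg_iff_isPositive C).2 hC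
  exact ⟨CFC.sqrt C, (ContinuousLinearMap.nonneg_iff_isPositive _).1 (CFC.sqrt_nonneg C),
    CFC.sqrt_mul_sqrt_self C h0⟩

theorem eq_zero_of_inner_hilbertBasis {ι : Type*} (e : HilbertBasis ι ℂ L2) {v : L2}
    (h : ∀ i, inner ℂ (e i) v = 0) : v = 0 := by
  have := tsum_enorm_sq_inner e v
  simp_rw [h] at this
  simpa using this.symm

/-- Let E be the zero set of the density and η = 1_E S v. Every S eᵢ vanishes on E, so (eᵢ, S η) =
(S eᵢ, η) = 0 for all i and S η = 0. Then ‖η‖² = (η, S v) = (S η, v) = 0. -/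
theorem apply_eq_zero_of_density_eq_zero {ι : Type*} [Countable ι] {S : L2 →L[ℂ] L2}
    (hS : S.IsPositive) (e : HilbertBasis ι ℂ L2) (v : L2) :
    ∀ᵐ x, density S e x = 0 → S v x = 0 := by
  set E : Set ℝ := {x | density S e x = 0} with hE
  have hEm : MeasurableSet E := measurable_density S e (measurableSet_singleton 0)
  have hm : MemLp (E.indicator (S v)) 2 volume := (Lp.memLp (S v)).indicator hEm
  set η : L2 := hm.toLp _ with hη
  have hηe : η =ᵐ[volume] E.indicator (S v) := hm.coeFn_toLp
  have hsymm : ∀ a b : L2, inner ℂ (S a) b = inner ℂ a (S b) := fun a b => hS.isSymmetric a b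
  have h0 : S η = 0 := by
    refine eq_zero_of_inner_hilbertBasis e fun i => ?_
    rw [← hsymm, L2.inner_def]
    refine integral_eq_zero_of_ae ?_
    filter_upwards [hηe] with x hx
    rw [hx]
    by_cases hxE : x ∈ E
    · have : density S e x = 0 := hxE
      rw [density, ENNReal.tsum_eq_zero] at this
      have h2 := this i
      rw [pow_eq_zero_iff two_ne_zero, enorm_eq_zero] at h2
      simp [h2]
    · simp [hxE]
  have h1 : ∫⁻ x, ‖η x‖ₑ ^ 2 = 0 := by
    have h2 : inner ℂ η η = 0 := by
      have : inner ℂ η η = inner ℂ η (S v) := by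
        rw [L2.inner_def, L2.inner_def]
        refine integral_congr_ae ?_
        filter_upwards [hηe] with x hx
        rw [hx]
        by_cases hxE : x ∈ E
        · rw [Set.indicator_of_mem hxE]
        · rw [Set.indicator_of_notMem hxE, inner_zero_left, inner_zero_left]
      rw [this, ← hsymm, h0, inner_zero_left]
    rw [lintegral_enorm_sq_eq, inner_self_eq_zero.1 h2]
    simp
  have hm2 : AEMeasurable (fun x => ‖η x‖ₑ ^ 2) volume :=
    (Lp.aestronglyMeasurable _).enorm.pow_const 2
  filter_upwards [(lintegral_eq_zero_iff' hm2).1 h1, hηe] with x hx hx2 hxE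
  simp only [Pi.zero_apply, pow_eq_zero_iff two_ne_zero, enorm_eq_zero] at hx
  rw [hx2, Set.indicator_of_mem (show x ∈ E from hxE)] at hx
  exact hx

theorem locallyIntegrable_of_bounded {g : ℝ → ℝ} (hg : Measurable g)
    (hgb : ∃ M, ∀ x, |g x| ≤ M) : LocallyIntegrable g := by
  obtain ⟨M, hM⟩ := hgb
  exact (locallyIntegrable_const M).mono hg.aestronglyMeasurable
    (ae_of_all _ fun x => (hM x).trans (le_abs_self M))

/-- The diagonal density of a positive commutator, with respect to a Hilbert basis. -/
theorem exists_diagonal_density {f g : ℝ → ℝ} (hf : Measurable f)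
    (hfb : ∃ M, ∀ x, |f x| ≤ M) (hg : Measurable g) (hgb : ∃ M, ∀ x, |g x| ≤ M) {a b : ℝ}
    (ha : Tendsto f atBot (𝓝 a)) (hb : Tendsto f atTop (𝓝 b))
    (hC : (commutator f g hf hfb hg hgb).IsPositive) {ι : Type*} (e : HilbertBasis ι ℂ L2) :
    ∃ w : ℝ → ℝ, Measurable w ∧ (∀ x, 0 ≤ w x) ∧ Integrable w ∧
      (∃ c, ∀ᵐ x, (∫ t in (0:ℝ)..x, w t) - (b - a) / (2 * Real.pi) * g x = c) ∧
      HasSum (fun i => inner ℂ (e i) (commutator f g hf hfb hg hgb (e i))) ((∫ x, w x : ℝ) : ℂ) ∧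
      ∀ ψ, ∀ᵐ x, w x = 0 → commutator f g hf hfb hg hgb ψ x = 0 := by
  have := countable_of_hilbertBasis e
  set C := commutator f g hf hfb hg hgb with hCdef
  obtain ⟨S, hS, hSC⟩ := exists_sqrt hC
  set D := density S e with hD
  have hDm : Measurable D := measurable_density S e
  set κ := (b - a) / (2 * Real.pi) with hκ
  have hκ2 : (b - a) / Real.pi = 2 * κ := by
    rw [hκ]; field_simp
  obtain ⟨hlt, hloc, c, hc⟩ := exists_ae_eq_primitive (D := D) hDm.aemeasurable
    (locallyIntegrable_of_bounded hg hgb) (κ := κ) (by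
      intro φ hφ hs
      have h2 := memLp_ofReal_of_compactSupport hφ.continuous hs 2
      have h3 := memLp_ofReal_of_compactSupport hφ.continuous hs ∞
      have h4 := lintegral_inner_commutator_modulate hf hfb hg hgb ha hb hC hφ hs h2
      rw [hκ2] at h4
      refine ⟨h4.1, ?_⟩
      rw [← h4.2]
      exact lintegral_density_mul C S hS hSC e h2 h3)
  set w : ℝ → ℝ := fun x => (D x).toReal with hw
  have hii : ∀ a b, IntervalIntegrable w volume a b := fun a b =>
    (hloc.integrableOn_isCompact isCompact_uIcc).intervalIntegrable
  have hw0 : ∀ x, 0 ≤ w x := fun x => ENNReal.toReal_nonneg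
  have hWc : Continuous fun x => ∫ t in (0:ℝ)..x, w t := intervalIntegral.continuous_primitive hii 0
  obtain ⟨M, hM⟩ := hgb
  -- The primitive equals c + κg almost everywhere; being continuous, it satisfies the resulting
  -- bound everywhere. As w ≥ 0, a bounded primitive makes w integrable.
  have hWb : ∀ x, |∫ t in (0:ℝ)..x, w t| ≤ |c| + |κ| * M := by
    have hd : Dense {x | |∫ t in (0:ℝ)..x, w t| ≤ |c| + |κ| * M} := by
      refine Measure.dense_of_ae (μ := volume) ?_
      filter_upwards [hc] with x hx
      have : ∫ t in (0:ℝ)..x, w t = c + κ * g x := by linarith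
      rw [this]
      refine (abs_add_le _ _).trans ?_
      rw [abs_mul]
      have := mul_le_mul_of_nonneg_left (hM x) (abs_nonneg κ)
      linarith
    have hcl : IsClosed {x | |∫ t in (0:ℝ)..x, w t| ≤ |c| + |κ| * M} :=
      isClosed_le hWc.abs continuous_const
    intro x
    have := hcl.closure_eq ▸ hd.closure_eq
    exact (this ▸ Set.mem_univ x : x ∈ {x | |∫ t in (0:ℝ)..x, w t| ≤ |c| + |κ| * M})
  have hwi : Integrable w := by
    refine integrable_of_intervalIntegral_norm_bounded (2 * (|c| + |κ| * M)) (l := atTop)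
      (a := fun A : ℝ => -A) (b := fun A => A) (fun A => (hii (-A) A).1) tendsto_neg_atTop_atBot
      tendsto_id (Eventually.of_forall fun A => ?_)
    simp only [Real.norm_eq_abs, abs_of_nonneg (hw0 _)]
    rw [← intervalIntegral.integral_add_adjacent_intervals (hii (-A) 0) (hii 0 A),
      intervalIntegral.integral_symm]
    have h1 := (abs_le.1 (hWb (-A))).1
    have h2 := (abs_le.1 (hWb A)).2
    linarith
  have hlint : ∫⁻ x, D x = ENNReal.ofReal (∫ x, w x) := by
    rw [ofReal_integral_eq_lintegral_ofReal hwi (ae_of_all _ hw0)]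
    refine lintegral_congr_ae ?_
    filter_upwards [hlt] with x hx
    rw [hw, ENNReal.ofReal_toReal hx.ne]
  have hsymm : ∀ a b : L2, inner ℂ (S a) b = inner ℂ a (S b) := fun a b => hS.isSymmetric a b
  have happ : ∀ ψ, C ψ = S (S ψ) := fun ψ => by rw [← hSC]; rfl
  refine ⟨w, hDm.ennreal_toReal, hw0, hwi, ⟨c, hc⟩, ?_, ?_⟩
  -- Each diagonal entry of C is ‖S eᵢ‖², and these sum to the integral of the density.
  · have hsum : ∑' i, ‖S (e i)‖ₑ ^ 2 = ENNReal.ofReal (∫ x, w x) := by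
      rw [← hlint, hD]
      unfold density
      rw [lintegral_tsum fun i => (Lp.aestronglyMeasurable _).enorm.pow_const 2]
      simp_rw [lintegral_enorm_sq_eq]
    have hs := ENNReal.hasSum_toReal (f := fun i => ‖S (e i)‖ₑ ^ 2)
      (by rw [hsum]; exact ENNReal.ofReal_ne_top)
    rw [← ENNReal.tsum_toReal_eq fun i => by simp, hsum,
      ENNReal.toReal_ofReal (integral_nonneg hw0)] at hs
    convert Complex.hasSum_ofReal.2 hs using 1
    funext i
    rw [happ, ← hsymm, inner_self_eq_norm_sq_to_K]
    simp
  · intro ψ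
    filter_upwards [apply_eq_zero_of_density_eq_zero hS e (S ψ), hlt] with x h1 h2 h3
    rw [happ]
    refine h1 ?_
    rcases (ENNReal.toReal_eq_zero_iff _).1 h3 with h | h
    · exact h
    · exact absurd h h2.ne

/-! ### Nonvanishing of [f] and the continuous representative of g -/

theorem bddAbove_range_of_bounded {F : ℝ → ℝ} (hb : ∃ M, ∀ x, |F x| ≤ M) :
    BddAbove (Set.range F) := by
  obtain ⟨M, hM⟩ := hb
  exact ⟨M, by rintro _ ⟨x, rfl⟩; exact (abs_le.1 (hM x)).2⟩

theorem bddBelow_range_of_bounded {F : ℝ → ℝ} (hb : ∃ M, ∀ x, |F x| ≤ M) :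
    BddBelow (Set.range F) := by
  obtain ⟨M, hM⟩ := hb
  exact ⟨-M, by rintro _ ⟨x, rfl⟩; exact (abs_le.1 (hM x)).1⟩

/-- If [f] = 0 the primitive of the diagonal density is constant, so the density is zero a.e., and C
vanishes where its density does. -/
theorem totalIncrease_pos_of_ne_zero {f g : ℝ → ℝ} (hf : Measurable f)
    (hfb : ∃ M, ∀ x, |f x| ≤ M) (hg : Measurable g) (hgb : ∃ M, ∀ x, |g x| ≤ M)
    (hmono : Monotone f) (hC : (commutator f g hf hfb hg hgb).IsPositive)
    (hne : commutator f g hf hfb hg hgb ≠ 0) : 0 < totalIncrease f := by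
  have ha := tendsto_atBot_ciInf hmono (bddBelow_range_of_bounded hfb)
  have hb := tendsto_atTop_ciSup hmono (bddAbove_range_of_bounded hfb)
  have h0 : 0 ≤ totalIncrease f := sub_nonneg.2 <|
    (ciInf_le (bddBelow_range_of_bounded hfb) 0).trans
      (le_ciSup (bddAbove_range_of_bounded hfb) 0)
  refine lt_of_le_of_ne h0 fun h => hne ?_
  obtain ⟨_, e, -⟩ := exists_hilbertBasis ℂ L2
  obtain ⟨w, -, hw0, hwi, ⟨c, hc⟩, -, hz⟩ :=
    exists_diagonal_density hf hfb hg hgb ha hb hC e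
  rw [show (⨆ x, f x) - ⨅ x, f x = 0 from h.symm] at hc
  have hWc : Continuous fun x => ∫ t in (0:ℝ)..x, w t :=
    intervalIntegral.continuous_primitive (fun _ _ => hwi.intervalIntegrable) 0
  have hW : (fun x => ∫ t in (0:ℝ)..x, w t) = fun _ => c := by
    rw [← hWc.ae_eq_iff_eq volume continuous_const]
    filter_upwards [hc] with x hx
    simpa using hx
  have hc0 : c = 0 := by
    have := congrFun hW 0
    simpa using this.symm
  have hlim : ∫ x, w x = 0 := by
    refine tendsto_nhds_unique
      (intervalIntegral_tendsto_integral hwi tendsto_neg_atTop_atBot tendsto_id)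
      (tendsto_const_nhds.congr fun A => ?_)
    have h1 : ∫ t in (0:ℝ)..A, w t = c := congrFun hW A
    have h2 : ∫ t in (0:ℝ)..(-A), w t = c := congrFun hW (-A)
    change 0 = ∫ t in (-A)..A, w t
    rw [← intervalIntegral.integral_add_adjacent_intervals
      (hwi.intervalIntegrable (a := -A) (b := 0)) (hwi.intervalIntegrable (a := 0) (b := A)),
      intervalIntegral.integral_symm, h1, h2, hc0]
    simp
  have hw : w =ᵐ[volume] 0 := (integral_eq_zero_iff_of_nonneg hw0 hwi).1 hlim
  refine ContinuousLinearMap.ext fun ψ => ?_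
  refine (Lp.eq_zero_iff_ae_eq_zero).2 ?_
  filter_upwards [hw, hz ψ] with x h1 h2 using h2 h1

/-- With κ = [f]/2π > 0, the relation W - κg = c between g and the primitive W of the density can be
solved for g; monotonicity comes from w ≥ 0 and boundedness from the integrability of w. -/
theorem exists_continuous_representative {f g : ℝ → ℝ} (hf : Measurable f)
    (hfb : ∃ M, ∀ x, |f x| ≤ M) (hg : Measurable g) (hgb : ∃ M, ∀ x, |g x| ≤ M)
    (hmono : Monotone f) (hC : (commutator f g hf hfb hg hgb).IsPositive)
    (hne : commutator f g hf hfb hg hgb ≠ 0) :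
    ∃ G : ℝ → ℝ, Continuous G ∧ Monotone G ∧ (∃ M, ∀ x, |G x| ≤ M) ∧ G =ᵐ[volume] g := by
  have hκ := totalIncrease_pos_of_ne_zero hf hfb hg hgb hmono hC hne
  have ha := tendsto_atBot_ciInf hmono (bddBelow_range_of_bounded hfb)
  have hb := tendsto_atTop_ciSup hmono (bddAbove_range_of_bounded hfb)
  obtain ⟨_, e, -⟩ := exists_hilbertBasis ℂ L2
  obtain ⟨w, -, hw0, hwi, ⟨c, hc⟩, -, -⟩ :=
    exists_diagonal_density hf hfb hg hgb ha hb hC e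
  change 0 < (⨆ x, f x) - ⨅ x, f x at hκ
  set κ := ((⨆ x, f x) - ⨅ x, f x) / (2 * Real.pi) with hκd
  have hκ0 : 0 < κ := div_pos hκ (by positivity)
  have hWc : Continuous fun x => ∫ t in (0:ℝ)..x, w t :=
    intervalIntegral.continuous_primitive (fun _ _ => hwi.intervalIntegrable) 0
  refine ⟨fun x => ((∫ t in (0:ℝ)..x, w t) - c) / κ, (hWc.sub continuous_const).div_const _,
    fun x y hxy => ?_, ⟨((∫ x, w x) + |c|) / κ, fun x => ?_⟩, ?_⟩
  · have := intervalIntegral.integral_add_adjacent_intervals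
      (hwi.intervalIntegrable (a := 0) (b := x)) (hwi.intervalIntegrable (a := x) (b := y))
    have h2 : 0 ≤ ∫ t in x..y, w t := intervalIntegral.integral_nonneg hxy fun t _ => hw0 t
    have h3 : (∫ t in (0:ℝ)..x, w t) ≤ ∫ t in (0:ℝ)..y, w t := by linarith
    exact div_le_div_of_nonneg_right (sub_le_sub_right h3 c) hκ0.le
  · rw [abs_div, abs_of_pos hκ0]
    refine div_le_div_of_nonneg_right ((abs_sub _ _).trans (add_le_add_left ?_ _)) hκ0.le
    have h1 : ‖∫ t in (0:ℝ)..x, w t‖ ≤ ∫ t in Set.uIoc 0 x, ‖w t‖ :=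
      intervalIntegral.norm_integral_le_integral_norm_uIoc
    simp only [Real.norm_eq_abs, abs_of_nonneg (hw0 _)] at h1
    refine h1.trans ?_
    exact setIntegral_le_integral hwi (ae_of_all _ hw0)
  · filter_upwards [hc] with x hx
    rw [div_eq_iff hκ0.ne']
    linarith

/-- For a continuous representative `G`, the function `G` is the primitive of an integrable density
outside whose support the commutator vanishes. -/
theorem exists_density {f G : ℝ → ℝ} (hf : Measurable f)
    (hfb : ∃ M, ∀ x, |f x| ≤ M) (hG : Measurable G) (hGb : ∃ M, ∀ x, |G x| ≤ M)
    (hmono : Monotone f) (hGc : Continuous G) (hGm : Monotone G)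
    (hC : (commutator f G hf hfb hG hGb).IsPositive)
    (hne : commutator f G hf hfb hG hGb ≠ 0) :
    (∃ w : ℝ → ℝ, Measurable w ∧ (∀ x, 0 ≤ w x) ∧ Integrable w ∧
      (∀ x, G x = G 0 + ∫ t in (0:ℝ)..x, w t) ∧
      ∀ ψ, ∀ᵐ x, w x = 0 → commutator f G hf hfb hG hGb ψ x = 0) ∧
    IsTraceClassWithTrace (commutator f G hf hfb hG hGb)
      (totalIncrease f * totalIncrease G / (2 * Real.pi)) := by
  have hκ := totalIncrease_pos_of_ne_zero hf hfb hG hGb hmono hC hne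
  have ha := tendsto_atBot_ciInf hmono (bddBelow_range_of_bounded hfb)
  have hb := tendsto_atTop_ciSup hmono (bddAbove_range_of_bounded hfb)
  change 0 < (⨆ x, f x) - ⨅ x, f x at hκ
  set κ := ((⨆ x, f x) - ⨅ x, f x) / (2 * Real.pi) with hκd
  have hκ0 : 0 < κ := div_pos hκ (by positivity)
  have prim : ∀ w : ℝ → ℝ, Integrable w → (∃ c, ∀ᵐ x, (∫ t in (0:ℝ)..x, w t) - κ * G x = c) →
      ∀ x, ∫ t in (0:ℝ)..x, w t = κ * (G x - G 0) := by
    rintro w hwi ⟨c, hc⟩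
    have hWc : Continuous fun x => (∫ t in (0:ℝ)..x, w t) - κ * G x :=
      (intervalIntegral.continuous_primitive (fun _ _ => hwi.intervalIntegrable) 0).sub
        (continuous_const.mul hGc)
    have hW : (fun x => (∫ t in (0:ℝ)..x, w t) - κ * G x) = fun _ => c := by
      rw [← hWc.ae_eq_iff_eq volume continuous_const]
      exact hc
    intro x
    have h1 := congrFun hW x
    have h2 := congrFun hW 0
    simp only [intervalIntegral.integral_same] at h1 h2
    linarith
  constructor
  · obtain ⟨_, e, -⟩ := exists_hilbertBasis ℂ L2
    obtain ⟨w, hwm, hw0, hwi, hc, -, hz⟩ := exists_diagonal_density hf hfb hG hGb ha hb hC e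
    refine ⟨fun x => w x / κ, hwm.div_const _, fun x => div_nonneg (hw0 x) hκ0.le,
      hwi.div_const _, fun x => ?_, fun ψ => ?_⟩
    · rw [intervalIntegral.integral_div, prim w hwi hc]
      field_simp
      ring
    · filter_upwards [hz ψ] with x h1 h2
      exact h1 ((div_eq_zero_iff.1 h2).resolve_right hκ0.ne')
  · refine ⟨hC, fun ι e => ?_⟩
    -- The density is constructed afresh for each basis, but its primitive is always κ(G - G(0)), so
    -- the trace κ[G] does not depend on the basis.
    obtain ⟨w, -, hw0, hwi, hc, hs, -⟩ := exists_diagonal_density hf hfb hG hGb ha hb hC e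
    convert hs using 2
    have h1 : Tendsto (fun A : ℝ => κ * (G A - G (-A))) atTop (𝓝 (κ * totalIncrease G)) := by
      have ga := tendsto_atBot_ciInf hGm (bddBelow_range_of_bounded hGb)
      have gb := tendsto_atTop_ciSup hGm (bddAbove_range_of_bounded hGb)
      exact (gb.sub (ga.comp tendsto_neg_atTop_atBot)).const_mul κ
    have h2 := intervalIntegral_tendsto_integral hwi tendsto_neg_atTop_atBot
      (tendsto_id (α := ℝ) (x := atTop))
    have h3 := tendsto_nhds_unique h1 (h2.congr fun A => by
      change ∫ t in (-A)..A, w t = _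
      rw [← intervalIntegral.integral_add_adjacent_intervals
        (hwi.intervalIntegrable (a := -A) (b := 0)) (hwi.intervalIntegrable (a := 0) (b := A)),
        intervalIntegral.integral_symm, prim w hwi hc, prim w hwi hc]
      ring)
    rw [← h3, hκd]
    unfold totalIncrease
    ring

/-! ### Difference quotients of primitives -/

section differenceQuotient

variable {G w : ℝ → ℝ}

theorem integral_eq_sub_of_primitive (hwi : Integrable w)
    (hG : ∀ x, G x = G 0 + ∫ t in (0:ℝ)..x, w t) (x y : ℝ) : ∫ t in x..y, w t = G y - G x := by
  have := intervalIntegral.integral_add_adjacent_intervals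
    (hwi.intervalIntegrable (a := 0) (b := x)) (hwi.intervalIntegrable (a := x) (b := y))
  rw [hG x, hG y]
  linarith

theorem continuous_of_primitive (hwi : Integrable w)
    (hG : ∀ x, G x = G 0 + ∫ t in (0:ℝ)..x, w t) : Continuous G := by
  rw [funext hG]
  exact continuous_const.add
    (intervalIntegral.continuous_primitive (fun _ _ => hwi.intervalIntegrable) 0)

theorem slope_eq_integral (hwi : Integrable w)
    (hG : ∀ x, G x = G 0 + ∫ t in (0:ℝ)..x, w t) (x : ℝ) {s : ℝ} (hs : s ≠ 0) :
    (G x - G (x + s)) / (x - (x + s)) = ∫ θ in (0:ℝ)..1, w (s * θ + x) := by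
  rw [intervalIntegral.integral_comp_mul_add w hs x, integral_eq_sub_of_primitive hwi hG]
  rw [mul_one, mul_zero, zero_add, add_comm s x]
  rw [show x - (x + s) = -s by ring, smul_eq_mul, div_eq_iff (neg_ne_zero.2 hs)]
  field_simp
  ring

/-- The quotient is the mean of w over the segment from x to x + s. Integrating in x first,
translation invariance bounds its L¹ norm over the square by 4R‖w‖₁, as s = y - x ranges over [-2R,
2R]. -/
theorem integrableOn_differenceQuotient (hw : Measurable w) (hwi : Integrable w)
    (hG : ∀ x, G x = G 0 + ∫ t in (0:ℝ)..x, w t) (R : ℝ) :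
    IntegrableOn (fun p : ℝ × ℝ => (G p.1 - G p.2) / (p.1 - p.2))
      (Set.Icc (-R) R ×ˢ Set.Icc (-R) R) (volume.prod volume) := by
  have hGc := continuous_of_primitive hwi hG
  have hqm : Measurable fun p : ℝ × ℝ => (G p.1 - G p.2) / (p.1 - p.2) :=
    ((hGc.measurable.comp measurable_fst).sub (hGc.measurable.comp measurable_snd)).div
      (measurable_fst.sub measurable_snd)
  have hmeas : MeasurableSet (Set.Icc (-R) R ×ˢ Set.Icc (-R) R) :=
    measurableSet_Icc.prod measurableSet_Icc
  refine ⟨hqm.aestronglyMeasurable, ?_⟩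
  rw [hasFiniteIntegral_iff_enorm, ← lintegral_indicator hmeas,
    lintegral_prod _ (hqm.enorm.indicator hmeas).aemeasurable]
  have b1 : ∀ x y : ℝ, (Set.Icc (-R) R ×ˢ Set.Icc (-R) R).indicator
      (fun p : ℝ × ℝ => ‖(G p.1 - G p.2) / (p.1 - p.2)‖ₑ) (x, y)
      ≤ (Set.Icc (-(2 * R)) (2 * R)).indicator
        (fun s => ‖(G x - G (x + s)) / (x - (x + s))‖ₑ) (y - x) := by
    intro x y
    refine Set.indicator_apply_le' (fun h => ?_) fun _ => zero_le
    have h2 : y - x ∈ Set.Icc (-(2 * R)) (2 * R) :=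
      ⟨by linarith [h.1.2, h.2.1], by linarith [h.1.1, h.2.2]⟩
    rw [Set.indicator_of_mem h2, add_sub_cancel]
  set J : Set ℝ := Set.Icc (-(2 * R)) (2 * R) with hJ
  have hwm2 : Measurable fun p : (ℝ × ℝ) × ℝ => ‖w (p.1.2 * p.2 + p.1.1)‖ₑ :=
    (hw.comp ((measurable_fst.snd.mul measurable_snd).add measurable_fst.fst)).enorm
  have b2 : ∀ x s : ℝ, s ≠ 0 → ‖(G x - G (x + s)) / (x - (x + s))‖ₑ
      ≤ ∫⁻ θ in Set.Ioc (0:ℝ) 1, ‖w (s * θ + x)‖ₑ := by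
    intro x s hs
    rw [slope_eq_integral hwi hG x hs, intervalIntegral.integral_of_le zero_le_one]
    exact enorm_integral_le_lintegral_enorm _
  have hmid : Measurable fun p : ℝ × ℝ =>
      ∫⁻ θ in Set.Ioc (0:ℝ) 1, ‖w (p.2 * θ + p.1)‖ₑ := hwm2.lintegral_prod_right'
  calc ∫⁻ x, ∫⁻ y, (Set.Icc (-R) R ×ˢ Set.Icc (-R) R).indicator
        (fun p : ℝ × ℝ => ‖(G p.1 - G p.2) / (p.1 - p.2)‖ₑ) (x, y)
      ≤ ∫⁻ x, ∫⁻ s, J.indicator (fun s => ‖(G x - G (x + s)) / (x - (x + s))‖ₑ) s := by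
        refine lintegral_mono fun x => (lintegral_mono (b1 x)).trans_eq ?_
        exact lintegral_sub_right_eq_self
          (J.indicator (fun s => ‖(G x - G (x + s)) / (x - (x + s))‖ₑ)) x
    _ ≤ ∫⁻ x, ∫⁻ s, J.indicator (fun s => ∫⁻ θ in Set.Ioc (0:ℝ) 1, ‖w (s * θ + x)‖ₑ) s := by
        refine lintegral_mono fun x => lintegral_mono_ae ?_
        filter_upwards [Measure.ae_ne volume (0 : ℝ)] with s hs
        exact Set.indicator_le_indicator (b2 x s hs)
    _ = ∫⁻ s in J, ∫⁻ x, ∫⁻ θ in Set.Ioc (0:ℝ) 1, ‖w (s * θ + x)‖ₑ := by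
        simp_rw [lintegral_indicator (show MeasurableSet J from measurableSet_Icc)]
        exact lintegral_lintegral_swap hmid.aemeasurable
    _ = ∫⁻ s in J, ∫⁻ θ in Set.Ioc (0:ℝ) 1, ∫⁻ x, ‖w (s * θ + x)‖ₑ := by
        refine lintegral_congr fun s => ?_
        refine lintegral_lintegral_swap (Measurable.aemeasurable ?_)
        exact (hw.comp ((measurable_snd.const_mul s).add measurable_fst)).enorm
    _ = ∫⁻ s in J, ∫⁻ θ in Set.Ioc (0:ℝ) 1, ∫⁻ x, ‖w x‖ₑ := by
        refine lintegral_congr fun s => lintegral_congr fun θ => ?_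
        exact lintegral_add_left_eq_self (fun x => ‖w x‖ₑ) (s * θ)
    _ < ∞ := by
        rw [setLIntegral_const, setLIntegral_const, hJ, Real.volume_Icc, Real.volume_Ioc]
        exact ENNReal.mul_lt_top (ENNReal.mul_lt_top hwi.2 ENNReal.ofReal_lt_top)
          ENNReal.ofReal_lt_top

end differenceQuotient

/-! ### Integration by parts against a primitive -/

/-- Fubini on {r ≤ t} replaces integration by parts, so v need only be integrable; the constant a
drops out because ∫ L' = 0. -/
theorem integral_primitive_mul_deriv {v : ℝ → ℝ} (hv : Integrable v) {L L' : ℝ → ℂ}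
    (hL : ∀ t, HasDerivAt L (L' t) t) (hL' : Integrable L') (ht : Tendsto L atTop (𝓝 0))
    (hb : Tendsto L atBot (𝓝 0)) (a : ℂ) :
    ∫ t, (a + ((∫ r in Set.Iic t, v r : ℝ) : ℂ)) * L' t = - ∫ r, (v r : ℂ) * L r := by
  have h0 : ∫ t, L' t = 0 := by
    rw [integral_of_hasDerivAt_of_tendsto hL hL' hb ht, sub_zero]
  have hset : MeasurableSet {p : ℝ × ℝ | p.2 ≤ p.1} := measurableSet_le measurable_snd measurable_fst
  have hint : Integrable (Function.uncurry fun t r : ℝ =>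
      {p : ℝ × ℝ | p.2 ≤ p.1}.indicator (fun p => L' p.1 * (v p.2 : ℂ)) (t, r))
      (volume.prod volume) :=
    (hL'.mul_prod hv.ofReal).indicator hset
  have e1 : ∀ t, ((∫ r in Set.Iic t, v r : ℝ) : ℂ) * L' t
      = ∫ r, {p : ℝ × ℝ | p.2 ≤ p.1}.indicator (fun p => L' p.1 * (v p.2 : ℂ)) (t, r) := by
    intro t
    have : ∀ r, {p : ℝ × ℝ | p.2 ≤ p.1}.indicator (fun p => L' p.1 * (v p.2 : ℂ)) (t, r)
        = (Set.Iic t).indicator (fun r => L' t * (v r : ℂ)) r := fun r => rfl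
    simp_rw [this]
    have h2 : ((∫ r in Set.Iic t, v r : ℝ) : ℂ) = ∫ r in Set.Iic t, (v r : ℂ) :=
      integral_ofReal.symm
    rw [integral_indicator measurableSet_Iic, integral_const_mul, h2, mul_comm]
  have e2 : ∀ r, ∫ t, {p : ℝ × ℝ | p.2 ≤ p.1}.indicator (fun p => L' p.1 * (v p.2 : ℂ)) (t, r)
      = - ((v r : ℂ) * L r) := by
    intro r
    have : ∀ t, {p : ℝ × ℝ | p.2 ≤ p.1}.indicator (fun p => L' p.1 * (v p.2 : ℂ)) (t, r)
        = (Set.Ici r).indicator (fun t => L' t * (v r : ℂ)) t := fun t => rfl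
    simp_rw [this]
    rw [integral_indicator measurableSet_Ici, integral_mul_const, integral_Ici_eq_integral_Ioi,
      integral_Ioi_of_hasDerivAt_of_tendsto' (fun x _ => hL x) hL'.integrableOn ht]
    ring
  have i1 : Integrable fun t => ((∫ r in Set.Iic t, v r : ℝ) : ℂ) * L' t := by
    simp_rw [e1]
    exact hint.integral_prod_left
  simp_rw [add_mul]
  rw [integral_add (hL'.const_mul a) i1, integral_const_mul, h0, mul_zero, zero_add]
  simp_rw [e1]
  rw [integral_integral_swap hint]
  simp_rw [e2]
  rw [integral_neg]

/-! ### The matrix elements of the commutator -/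

section matrixElements

variable {A B : Set ℝ} {R : ℝ}

/-- The cut-off difference quotient `1_A(x) 1_B(y) (G x - G y) / (x - y)`. -/
def cutQuotient (G : ℝ → ℝ) (A B : Set ℝ) (p : ℝ × ℝ) : ℂ :=
  (A ×ˢ B).indicator (fun p => (((G p.1 - G p.2) / (p.1 - p.2) : ℝ) : ℂ)) p

theorem integrable_cutQuotient {G w : ℝ → ℝ} (hw : Measurable w) (hwi : Integrable w)
    (hG : ∀ x, G x = G 0 + ∫ t in (0:ℝ)..x, w t) (hA : MeasurableSet A) (hB : MeasurableSet B)
    (hAR : A ⊆ Set.Icc (-R) R) (hBR : B ⊆ Set.Icc (-R) R) :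
    Integrable (cutQuotient G A B) (volume.prod volume) := by
  have h := (integrableOn_differenceQuotient hw hwi hG R).mono_set (Set.prod_mono hAR hBR)
  exact (IntegrableOn.integrable_indicator h (hA.prod hB)).ofReal.congr (ae_of_all _ fun p => by
    simp only [cutQuotient, Set.indicator]
    split_ifs <;> simp)

/-- The measure preserving shear (x, s) ↦ (x, x + s) isolates the difference variable on which V
depends. -/
theorem integral_fourierChar_mul {N : ℝ × ℝ → ℂ} (hN : Integrable N (volume.prod volume))
    {V : ℝ → ℂ} (hV : Continuous V) (hVb : ∃ M, ∀ s, ‖V s‖ ≤ M) :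
    Integrable (fun s => V s * ∫ x, N (x, x + s)) ∧
    ∫ p, V (p.2 - p.1) * N p ∂(volume.prod volume) = ∫ s, V s * ∫ x, N (x, x + s) := by
  obtain ⟨M, hM⟩ := hVb
  have hT := measurePreserving_prod_add (volume : Measure ℝ) (volume : Measure ℝ)
  have hi : Integrable (fun p : ℝ × ℝ => V (p.2 - p.1) * N p) (volume.prod volume) := by
    refine (hN.const_mul (M : ℂ)).mono (AEStronglyMeasurable.mul
      (hV.comp (continuous_snd.sub continuous_fst)).aestronglyMeasurable hN.1)
      (ae_of_all _ fun p => ?_)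
    rw [norm_mul, norm_mul, Complex.norm_real]
    exact mul_le_mul_of_nonneg_right ((hM _).trans (le_abs_self M)) (norm_nonneg _)
  have hi2 : Integrable (fun z : ℝ × ℝ => V z.2 * N (z.1, z.1 + z.2)) (volume.prod volume) := by
    refine ((hT.integrable_comp_of_integrable hi)).congr (ae_of_all _ fun z => ?_)
    simp
  have e : ∀ s, ∫ x, V s * N (x, x + s) = V s * ∫ x, N (x, x + s) := fun s =>
    integral_const_mul _ _
  constructor
  · simp_rw [← e]
    exact hi2.integral_prod_right
  · simp_rw [← e]
    have e2 := hT.integral_comp' (f := MeasurableEquiv.shearAddRight ℝ)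
      (fun p : ℝ × ℝ => V (p.2 - p.1) * N p)
    rw [← e2, ← integral_prod_symm _ hi2]
    refine integral_congr_ae (ae_of_all _ fun z => ?_)
    have h : MeasurableEquiv.shearAddRight ℝ z = (z.1, z.1 + z.2) := rfl
    simp only [h, add_sub_cancel_left]

/-- The rescaled density `2π v (2π ·)`. -/
def rescale (v : ℝ → ℝ) (r : ℝ) : ℝ := 2 * Real.pi * v (2 * Real.pi * r)

theorem integrable_rescale {v : ℝ → ℝ} (hv : Integrable v) : Integrable (rescale v) :=
  (hv.comp_mul_left' (by positivity : 2 * Real.pi ≠ 0)).const_mul _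

theorem primitive_rescale {F v : ℝ → ℝ} (hvi : Integrable v)
    (hF : ∀ x, F x = F 0 + ∫ t in (0:ℝ)..x, v t) (t : ℝ) :
    F (2 * Real.pi * t) = (F 0 - ∫ r in Set.Iic 0, rescale v r) + ∫ r in Set.Iic t, rescale v r := by
  have h1 : ∫ r in (0:ℝ)..t, rescale v r = ∫ t in (0:ℝ)..(2 * Real.pi * t), v t := by
    unfold rescale
    rw [intervalIntegral.integral_const_mul,
      intervalIntegral.integral_comp_mul_left v (by positivity : 2 * Real.pi ≠ 0), mul_zero,
      smul_eq_mul, ← mul_assoc, mul_inv_cancel₀ (by positivity), one_mul]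
  have h2 := intervalIntegral.integral_Iic_sub_Iic (μ := volume) (a := 0) (b := t)
    (integrable_rescale hvi).integrableOn (integrable_rescale hvi).integrableOn
  rw [hF, ← h1, ← h2]
  ring

theorem memLp_indicator_one (hA : MeasurableSet A) (hAR : A ⊆ Set.Icc (-R) R) (p : ℝ≥0∞) :
    MemLp (A.indicator fun _ => (1 : ℂ)) p volume :=
  memLp_indicator_const p hA 1
    (Or.inr ((measure_mono hAR).trans_lt (by simp [Real.volume_Icc])).ne)

/-- The form is i∫ F(2πt) J(t) dt. Let N be the cut-off quotient and k(s) = ∫ N(x, x + s) dx. Then J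
is the Fourier transform of s k(s), hence a multiple of (𝓕k)'. Integration by parts puts the
derivative on F, the transform is moved from k to the density of F, and undoing the shear gives the
double integral. -/
theorem inner_commutator_indicator {F G v w : ℝ → ℝ} (hFm : Measurable F)
    (hFb : ∃ M, ∀ x, |F x| ≤ M) (hGm : Measurable G) (hGb : ∃ M, ∀ x, |G x| ≤ M)
    (hvi : Integrable v) (hF : ∀ x, F x = F 0 + ∫ t in (0:ℝ)..x, v t)
    (hw : Measurable w) (hwi : Integrable w) (hG : ∀ x, G x = G 0 + ∫ t in (0:ℝ)..x, w t)
    (hA : MeasurableSet A) (hB : MeasurableSet B)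
    (hAR : A ⊆ Set.Icc (-R) R) (hBR : B ⊆ Set.Icc (-R) R) :
    inner ℂ ((memLp_indicator_one hA hAR 2).toLp _)
      (commutator F G hFm hFb hGm hGb ((memLp_indicator_one hB hBR 2).toLp _)) =
    (1 / (2 * Real.pi) : ℝ) * ∫ p, 𝓕 (fun r => (rescale v r : ℂ)) (p.2 - p.1) * cutQuotient G A B p
      ∂(volume.prod volume) := by
  have hpi := Real.pi_pos
  set pA : ℝ → ℂ := A.indicator fun _ => (1 : ℂ) with hpA
  set pB : ℝ → ℂ := B.indicator fun _ => (1 : ℂ) with hpB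
  have A2 : MemLp pA 2 volume := memLp_indicator_one hA hAR 2
  have B2 : MemLp pB 2 volume := memLp_indicator_one hB hBR 2
  have A1' := memLp_indicator_one hA hAR 1
  have B1' := memLp_indicator_one hB hBR 1
  have A1 : Integrable pA := memLp_one_iff_integrable.1 A1'
  have B1 : Integrable pB := memLp_one_iff_integrable.1 B1'
  set gA : ℝ → ℂ := fun x => (G x : ℂ) * pA x with hgA
  set gB : ℝ → ℂ := fun x => (G x : ℂ) * pB x with hgB
  have gA2 : MemLp gA 2 volume := memLp_mul_of_bounded hGm hGb A2
  have gB2 : MemLp gB 2 volume := memLp_mul_of_bounded hGm hGb B2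
  have gA1 : Integrable gA := memLp_one_iff_integrable.1 (memLp_mul_of_bounded hGm hGb A1')
  have gB1 : Integrable gB := memLp_one_iff_integrable.1 (memLp_mul_of_bounded hGm hGb B1')
  have qA : funQ G hGm hGb (A2.toLp pA) = gA2.toLp gA := by
    refine Lp.ext ?_
    filter_upwards [funQ_apply_ae G hGm hGb (A2.toLp pA), A2.coeFn_toLp, gA2.coeFn_toLp] with x a b c
    rw [a, b, c]
  have qB : funQ G hGm hGb (B2.toLp pB) = gB2.toLp gB := by
    refine Lp.ext ?_
    filter_upwards [funQ_apply_ae G hGm hGb (B2.toLp pB), B2.coeFn_toLp, gB2.coeFn_toLp] with x a b c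
    rw [a, b, c]
  set J : ℝ → ℂ := fun t => conj (𝓕 pA t) * 𝓕 gB t - conj (𝓕 gA t) * 𝓕 pB t with hJ
  have hJi : Integrable J := (integrable_conj_fourier_mul_fourier A1 A2 gB1 gB2).sub
    (integrable_conj_fourier_mul_fourier gA1 gA2 B1 B2)
  set N := cutQuotient G A B with hN
  have hNi : Integrable N (volume.prod volume) := integrable_cutQuotient hw hwi hG hA hB hAR hBR
  set k : ℝ → ℂ := fun s => ∫ x, N (x, x + s) with hk
  have hki : Integrable k := by
    have := (integral_fourierChar_mul hNi (V := fun _ => 1) continuous_const ⟨1, by simp⟩).1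
    simpa using this
  set H : ℝ × ℝ → ℂ := fun p => pA p.1 * gB p.2 - gA p.1 * pB p.2 with hH
  have hHi : Integrable H (volume.prod volume) := (A1.mul_prod gB1).sub (gA1.mul_prod B1)
  -- The commutator structure produces the factor G(y) - G(x), which is y - x times the difference
  -- quotient, on the diagonal too.
  have hHN : ∀ p : ℝ × ℝ, H p = ((p.2 - p.1 : ℝ) : ℂ) * N p := by
    rintro ⟨x, y⟩
    simp only [hH, hN, hgA, hgB, hpA, hpB, cutQuotient, Set.indicator, Set.mem_prod]
    by_cases hx : x ∈ A
    · by_cases hy : y ∈ B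
      · have hm : (x, y) ∈ A ×ˢ B := ⟨hx, hy⟩
        simp only [hx, hy, hm, if_true]
        by_cases hxy : x = y
        · simp [hxy]
        · have : (x : ℂ) - y ≠ 0 := sub_ne_zero.2 (by exact_mod_cast hxy)
          push_cast
          field_simp
          ring
      · simp [hy]
    · simp [hx]
  have hHk : ∀ s, ∫ x, H (x, x + s) = (s : ℂ) * k s := by
    intro s
    rw [hk, ← integral_const_mul]
    refine integral_congr_ae (ae_of_all _ fun x => ?_)
    simp only [hHN, add_sub_cancel_left]
  have hski : Integrable fun s : ℝ => s • k s := by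
    have := (integral_fourierChar_mul hHi (V := fun _ => 1) continuous_const ⟨1, by simp⟩).1
    simpa [hHk] using this
  have conjA : ∀ {p : ℝ → ℂ} (t : ℝ), (∀ x, conj (p x) = p x) →
      conj (𝓕 p t) = ∫ x, (Real.fourierChar (x * t) : ℂ) * p x := by
    intro p t hp
    rw [Real.fourier_real_eq, ← integral_conj]
    refine integral_congr_ae (ae_of_all _ fun x => ?_)
    simp only [Circle.smul_def, smul_eq_mul, map_mul, hp]
    congr 1
    rw [← Circle.coe_inv_eq_conj, ← AddChar.map_neg_eq_inv, neg_neg]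
  have rA : ∀ x, conj (pA x) = pA x := fun x => by
    simp only [hpA, Set.indicator]
    split_ifs <;> simp
  have rgA : ∀ x, conj (gA x) = gA x := fun x => by
    simp only [hgA, map_mul, rA, Complex.conj_ofReal]
  have hJF : ∀ t, 𝓕 (fun s : ℝ => (s : ℂ) * k s) t = J t := by
    intro t
    have hVc : Continuous fun s : ℝ => ((Real.fourierChar (-(s * t)) : Circle) : ℂ) :=
      continuous_subtype_val.comp (Real.continuous_fourierChar.comp (by fun_prop))
    have h1 := (integral_fourierChar_mul hHi hVc ⟨1, fun s => (Circle.norm_coe _).le⟩).2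
    simp_rw [hHk] at h1
    rw [Real.fourier_real_eq]
    simp_rw [Circle.smul_def, smul_eq_mul]
    rw [← h1]
    have i1 : ∀ {p : ℝ → ℂ}, Integrable p →
        Integrable fun x => (Real.fourierChar (x * t) : ℂ) * p x := fun {p} hp =>
      (Real.fourierIntegral_convergent_iff (-t)).2 hp |>.congr (ae_of_all _ fun x => by
        simp [Circle.smul_def, mul_comm])
    have i2 : ∀ {p : ℝ → ℂ}, Integrable p →
        Integrable fun x => (Real.fourierChar (-(x * t)) : ℂ) * p x := fun {p} hp =>
      (Real.fourierIntegral_convergent_iff t).2 hp |>.congr (ae_of_all _ fun x => by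
        simp [Circle.smul_def, mul_comm])
    have e1 : ∀ p : ℝ × ℝ, (Real.fourierChar (-((p.2 - p.1) * t)) : ℂ) * H p =
        ((Real.fourierChar (p.1 * t) : ℂ) * pA p.1) *
          ((Real.fourierChar (-(p.2 * t)) : ℂ) * gB p.2) -
        ((Real.fourierChar (p.1 * t) : ℂ) * gA p.1) *
          ((Real.fourierChar (-(p.2 * t)) : ℂ) * pB p.2) := by
      intro p
      rw [show -((p.2 - p.1) * t) = p.1 * t + -(p.2 * t) by ring, AddChar.map_add_eq_mul,
        Circle.coe_mul]
      simp only [hH]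
      ring
    simp_rw [e1]
    rw [integral_sub ((i1 A1).mul_prod (i2 gB1)) ((i1 gA1).mul_prod (i2 B1))]
    have e3 : ∀ p : ℝ → ℂ, ∫ x, (Real.fourierChar (-(x * t)) : ℂ) * p x = 𝓕 p t := fun p => by
      rw [Real.fourier_real_eq]
      rfl
    have e4 : ∀ p q : ℝ → ℂ, (∀ x, conj (p x) = p x) →
        ∫ z : ℝ × ℝ, ((Real.fourierChar (z.1 * t) : ℂ) * p z.1) *
          ((Real.fourierChar (-(z.2 * t)) : ℂ) * q z.2) ∂(volume.prod volume) =
        conj (𝓕 p t) * 𝓕 q t := fun p q hp => by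
      rw [conjA t hp, ← e3 q]
      exact integral_prod_mul (fun x => (Real.fourierChar (x * t) : ℂ) * p x)
        fun x => (Real.fourierChar (-(x * t)) : ℂ) * q x
    exact congrArg₂ (· - ·) (e4 pA gB rA) (e4 gA pB rgA)
  have hL : ∀ t, HasDerivAt (𝓕 k) (-2 * Real.pi * Complex.I * J t) t := by
    intro t
    have e : 𝓕 (fun x : ℝ => (-2 * Real.pi * Complex.I * x) • k x) t =
        -2 * Real.pi * Complex.I * J t := by
      rw [← hJF, Real.fourier_real_eq, Real.fourier_real_eq, ← integral_const_mul]
      refine integral_congr_ae (ae_of_all _ fun x => ?_)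
      simp only [Circle.smul_def, smul_eq_mul]
      ring
    rw [← e]
    exact Real.hasDerivAt_fourier hki hski t
  -- The Riemann-Lebesgue lemma removes the boundary terms.
  have hRL := Real.zero_at_infty_fourier k
  set v1 : ℝ → ℂ := fun r => (rescale v r : ℂ) with hv1
  have hv1i : Integrable v1 := (integrable_rescale hvi).ofReal
  have h1 := integral_primitive_mul_deriv (integrable_rescale hvi) hL (hJi.const_mul _)
    (hRL.mono_left atTop_le_cocompact) (hRL.mono_left atBot_le_cocompact)
    ((F 0 - ∫ r in Set.Iic 0, rescale v r : ℝ) : ℂ)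
  have h2 : ∫ t, (F (2 * Real.pi * t) : ℂ) * J t =
      (1 / (2 * Real.pi * Complex.I)) * ∫ r, v1 r * 𝓕 k r := by
    have : ∫ t, (F (2 * Real.pi * t) : ℂ) * (-2 * Real.pi * Complex.I * J t) =
        - ∫ r, v1 r * 𝓕 k r := by
      rw [← h1]
      refine integral_congr_ae (ae_of_all _ fun t => ?_)
      simp only [primitive_rescale hvi hF t, Complex.ofReal_add]
    rw [show (∫ r, v1 r * 𝓕 k r) = -∫ t, (F (2 * Real.pi * t) : ℂ) *
      (-2 * Real.pi * Complex.I * J t) by rw [this, neg_neg], ← integral_neg, ← integral_const_mul]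
    refine integral_congr_ae (ae_of_all _ fun t => ?_)
    have : (Real.pi : ℂ) ≠ 0 := by exact_mod_cast hpi.ne'
    field_simp
  have h3 : ∫ r, v1 r * 𝓕 k r = ∫ s, 𝓕 v1 s * k s := by
    have := VectorFourier.integral_fourierIntegral_smul_eq_flip (μ := (volume : Measure ℝ))
      (ν := (volume : Measure ℝ)) (L := innerₗ ℝ) Real.continuous_fourierChar (by fun_prop) hv1i hki
    rw [flip_innerₗ] at this
    exact this.symm
  have h4 : ∀ s, ‖𝓕 v1 s‖ ≤ ∫ r, ‖v1 r‖ := fun s =>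
    VectorFourier.norm_fourierIntegral_le_integral_norm _ _ _ _ _
  have h5 : Continuous (𝓕 v1) :=
    VectorFourier.fourierIntegral_continuous Real.continuous_fourierChar (by fun_prop) hv1i
  rw [(integral_fourierChar_mul hNi h5 ⟨_, h4⟩).2, ← h3, inner_commutator, qA, qB]
  have h6 : ∫ t, (F (2 * Real.pi * t) : ℂ) *
      (conj (FT (A2.toLp pA) t) * FT (gB2.toLp gB) t -
        conj (FT (gA2.toLp gA) t) * FT (B2.toLp pB) t) = ∫ t, (F (2 * Real.pi * t) : ℂ) * J t := by
    refine integral_congr_ae ?_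
    filter_upwards [FT_toLp_ae A1 A2, FT_toLp_ae B1 B2, FT_toLp_ae gA1 gA2, FT_toLp_ae gB1 gB2]
      with t a b c d
    rw [a, b, c, d]
  rw [h6, h2]
  push_cast
  have : (Real.pi : ℂ) ≠ 0 := by exact_mod_cast hpi.ne'
  field_simp

end matrixElements

/-! ### The kernel in terms of the densities -/

section kernel

variable {F G v w : ℝ → ℝ} {A B : Set ℝ} {R : ℝ}

theorem stieltjesFunction_measure_eq_withDensity (hFm : Monotone F) (hv0 : ∀ x, 0 ≤ v x)
    (hvi : Integrable v) (hF : ∀ x, F x = F 0 + ∫ t in (0:ℝ)..x, v t) :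
    hFm.stieltjesFunction.measure = volume.withDensity fun x => ENNReal.ofReal (v x) := by
  have hr : ∀ x, hFm.stieltjesFunction x = F x := fun x => by
    rw [hFm.stieltjesFunction_eq]
    exact ((continuous_of_primitive hvi hF).continuousAt.continuousWithinAt).rightLim_eq
  refine Measure.ext_of_Ioc' _ _ (fun a b _ => ?_) fun a b hab => ?_
  · rw [StieltjesFunction.measure_Ioc]
    exact ENNReal.ofReal_ne_top
  · rw [StieltjesFunction.measure_Ioc, hr, hr, withDensity_apply _ measurableSet_Ioc,
      ← integral_eq_sub_of_primitive hvi hF, intervalIntegral.integral_of_le hab.le,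
      ofReal_integral_eq_lintegral_ofReal hvi.integrableOn (ae_of_all _ hv0)]

/-- The substitution ξ = 2πr reconciles the kernel exp(-isξ) with exp(-2πisr); its Jacobian is the
factor in `rescale`. -/
theorem fourierStieltjes_eq (hFm : Monotone F) (hv : Measurable v) (hv0 : ∀ x, 0 ≤ v x)
    (hvi : Integrable v) (hF : ∀ x, F x = F 0 + ∫ t in (0:ℝ)..x, v t) (s : ℝ) :
    fourierStieltjes F hFm s =
      ((1 / Real.sqrt (2 * Real.pi) : ℝ) : ℂ) * 𝓕 (fun r => (rescale v r : ℂ)) s := by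
  have hpi : (0:ℝ) < 2 * Real.pi := by positivity
  rw [fourierStieltjes, stieltjesFunction_measure_eq_withDensity hFm hv0 hvi hF,
    integral_withDensity_eq_integral_toReal_smul hv.ennreal_ofReal
      (ae_of_all _ fun _ => ENNReal.ofReal_lt_top), Real.fourier_real_eq_integral_exp_smul]
  have h := Measure.integral_comp_mul_left (fun ξ : ℝ => (ENNReal.ofReal (v ξ)).toReal •
    Complex.exp (-(Complex.I * s * ξ))) (2 * Real.pi)
  rw [abs_of_pos (inv_pos.2 hpi), eq_inv_smul_iff₀ hpi.ne', ← integral_smul] at h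
  rw [← h]
  congr 1
  refine integral_congr_ae (ae_of_all _ fun r => ?_)
  have h2 : -(Complex.I * s * ((2 * Real.pi * r : ℝ) : ℂ)) =
      ((-2 * Real.pi * r * s : ℝ) : ℂ) * Complex.I := by
    push_cast
    ring
  have h3 : ((rescale v r : ℝ) : ℂ) =
      ((2 * Real.pi : ℝ) : ℂ) * ((v (2 * Real.pi * r) : ℝ) : ℂ) := Complex.ofReal_mul _ _
  simp only [ENNReal.toReal_ofReal (hv0 _), h2, h3, Complex.real_smul, smul_eq_mul]
  ring

theorem kernel_eq (hFm : Monotone F) (hv : Measurable v) (hv0 : ∀ x, 0 ≤ v x)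
    (hvi : Integrable v) (hF : ∀ x, F x = F 0 + ∫ t in (0:ℝ)..x, v t) (x y : ℝ) :
    kernel F G hFm x y = ((1 / (2 * Real.pi) : ℝ) : ℂ) * 𝓕 (fun r => (rescale v r : ℂ)) (y - x) *
      (((G x - G y) / (x - y) : ℝ) : ℂ) := by
  have h : ((1 / Real.sqrt (2 * Real.pi) : ℝ) : ℂ) * ((1 / Real.sqrt (2 * Real.pi) : ℝ) : ℂ) =
      ((1 / (2 * Real.pi) : ℝ) : ℂ) := by
    rw [← Complex.ofReal_mul, div_mul_div_comm, Real.mul_self_sqrt (by positivity), one_mul]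
  rw [kernel, fourierStieltjes_eq hFm hv hv0 hvi hF, ← h]
  ring

theorem continuous_fourier_rescale (hvi : Integrable v) :
    Continuous (𝓕 (fun r => (rescale v r : ℂ))) :=
  VectorFourier.fourierIntegral_continuous Real.continuous_fourierChar (by fun_prop)
    (integrable_rescale hvi).ofReal

theorem measurable_kernel (hFm : Monotone F) (hv : Measurable v) (hv0 : ∀ x, 0 ≤ v x)
    (hvi : Integrable v) (hF : ∀ x, F x = F 0 + ∫ t in (0:ℝ)..x, v t) (hGm : Measurable G) :
    Measurable fun p : ℝ × ℝ => kernel F G hFm p.1 p.2 := by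
  simp_rw [kernel_eq hFm hv hv0 hvi hF]
  have h1 : Measurable fun p : ℝ × ℝ => 𝓕 (fun r => (rescale v r : ℂ)) (p.2 - p.1) :=
    (continuous_fourier_rescale hvi).measurable.comp (measurable_snd.sub measurable_fst)
  have h2 : Measurable fun p : ℝ × ℝ => (((G p.1 - G p.2) / (p.1 - p.2) : ℝ) : ℂ) :=
    Complex.measurable_ofReal.comp (((hGm.comp measurable_fst).sub (hGm.comp measurable_snd)).div
      (measurable_fst.sub measurable_snd))
  exact (h1.const_mul _).mul h2

theorem integrableOn_kernel (hFm : Monotone F) (hv : Measurable v) (hv0 : ∀ x, 0 ≤ v x)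
    (hvi : Integrable v) (hF : ∀ x, F x = F 0 + ∫ t in (0:ℝ)..x, v t)
    (hw : Measurable w) (hwi : Integrable w) (hG : ∀ x, G x = G 0 + ∫ t in (0:ℝ)..x, w t) (R : ℝ) :
    IntegrableOn (fun p : ℝ × ℝ => kernel F G hFm p.1 p.2)
      (Set.Icc (-R) R ×ˢ Set.Icc (-R) R) (volume.prod volume) := by
  have hGm := (continuous_of_primitive hwi hG).measurable
  refine Integrable.mono' (((integrableOn_differenceQuotient hw hwi hG R).norm).const_mul
    ((1 / (2 * Real.pi)) * ∫ r, ‖(rescale v r : ℂ)‖))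
    (measurable_kernel hFm hv hv0 hvi hF hGm).aestronglyMeasurable (ae_of_all _ fun p => ?_)
  rw [kernel_eq hFm hv hv0 hvi hF, norm_mul, norm_mul, Complex.norm_real, Complex.norm_real,
    Real.norm_of_nonneg (by positivity : 0 ≤ 1 / (2 * Real.pi))]
  gcongr
  exact VectorFourier.norm_fourierIntegral_le_integral_norm _ _ _ _ _

theorem inner_commutator_indicator_eq_integral_kernel (hFm : Monotone F)
    (hFb : ∃ M, ∀ x, |F x| ≤ M) (hGm : Measurable G) (hGb : ∃ M, ∀ x, |G x| ≤ M)
    (hv : Measurable v) (hv0 : ∀ x, 0 ≤ v x)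
    (hvi : Integrable v) (hF : ∀ x, F x = F 0 + ∫ t in (0:ℝ)..x, v t)
    (hw : Measurable w) (hwi : Integrable w) (hG : ∀ x, G x = G 0 + ∫ t in (0:ℝ)..x, w t)
    (hA : MeasurableSet A) (hB : MeasurableSet B)
    (hAR : A ⊆ Set.Icc (-R) R) (hBR : B ⊆ Set.Icc (-R) R) :
    inner ℂ ((memLp_indicator_one hA hAR 2).toLp _)
      (commutator F G hFm.measurable hFb hGm hGb ((memLp_indicator_one hB hBR 2).toLp _)) =
    ∫ p in A ×ˢ B, kernel F G hFm p.1 p.2 ∂(volume.prod volume) := by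
  rw [inner_commutator_indicator hFm.measurable hFb hGm hGb hvi hF hw hwi hG hA hB hAR hBR,
    ← integral_const_mul, ← integral_indicator (hA.prod hB)]
  refine integral_congr_ae (ae_of_all _ fun p => ?_)
  simp only [cutQuotient, Set.indicator]
  split_ifs
  · rw [kernel_eq hFm hv hv0 hvi hF]
    ring
  · simp

end kernel

/-! ### Hilbert-Schmidt kernels -/

theorem memLp_tensor (a b : L2) :
    MemLp (fun p : ℝ × ℝ => a p.1 * conj (b p.2)) 2 (volume.prod volume) := by
  have ha := Lp.memLp a
  have hb := Lp.memLp b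
  have hm : AEStronglyMeasurable (fun p : ℝ × ℝ => a p.1 * conj (b p.2)) (volume.prod volume) :=
    (ha.1.comp_fst).mul (Complex.continuous_conj.comp_aestronglyMeasurable hb.1.comp_snd)
  rw [memLp_two_iff_integrable_sq_norm hm]
  have := ((memLp_two_iff_integrable_sq_norm ha.1).1 ha).mul_prod
    ((memLp_two_iff_integrable_sq_norm hb.1).1 hb)
  refine this.congr (ae_of_all _ fun p => ?_)
  simp only [norm_mul, RCLike.norm_conj, mul_pow]

/-- The square integrable function `a(x) conj b(y)` on `ℝ²`. -/
def tensor (a b : L2) : Lp ℂ 2 ((volume : Measure ℝ).prod (volume : Measure ℝ)) :=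
  (memLp_tensor a b).toLp _

theorem inner_tensor (a b c d : L2) :
    inner ℂ (tensor a b) (tensor c d) = inner ℂ a c * inner ℂ d b := by
  rw [L2.inner_def, L2.inner_def, L2.inner_def, ← integral_prod_mul]
  refine integral_congr_ae ?_
  filter_upwards [(memLp_tensor a b).coeFn_toLp, (memLp_tensor c d).coeFn_toLp] with p h1 h2
  simp only [tensor, h1, h2, RCLike.inner_apply, map_mul, RCLike.conj_conj]
  ring

theorem norm_tensor (a b : L2) : ‖tensor a b‖ = ‖a‖ * ‖b‖ := by
  have h : ‖tensor a b‖ ^ 2 = (‖a‖ * ‖b‖) ^ 2 := by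
    have := inner_tensor a b a b
    simp only [inner_self_eq_norm_sq_to_K] at this
    rw [mul_pow]
    exact_mod_cast this
  exact (pow_left_inj₀ (norm_nonneg _) (by positivity) two_ne_zero).1 h

/-- The kernel is the sum of the tensors of C eᵢ with eᵢ. They are pairwise orthogonal with norms ‖C
eᵢ‖, so the series converges in L²(ℝ²). -/
theorem exists_hilbertSchmidt_kernel (C : L2 →L[ℂ] L2) {ι : Type*} (e : HilbertBasis ι ℂ L2)
    (h : Summable fun i => ‖C (e i)‖ ^ 2) :
    ∃ k : Lp ℂ 2 ((volume : Measure ℝ).prod (volume : Measure ℝ)), ∀ φ ψ : L2,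
      inner ℂ (tensor φ ψ) k = inner ℂ φ (C ψ) := by
  classical
  set u : ι → Lp ℂ 2 ((volume : Measure ℝ).prod (volume : Measure ℝ)) :=
    fun i => tensor (C (e i)) (e i) with hu
  have horth : ∀ i j, i ≠ j → inner ℂ (u i) (u j) = 0 := fun i j hij => by
    rw [hu, inner_tensor, e.orthonormal.2 hij.symm, mul_zero]
  have hfam : OrthogonalFamily ℂ (fun i => (ℂ ∙ u i))
      fun i => (ℂ ∙ u i).subtypeₗᵢ := fun i j hij a b => by
    obtain ⟨c, hc⟩ := Submodule.mem_span_singleton.1 a.2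
    obtain ⟨d, hd⟩ := Submodule.mem_span_singleton.1 b.2
    change inner ℂ (a : Lp ℂ 2 ((volume : Measure ℝ).prod (volume : Measure ℝ))) b = 0
    rw [← hc, ← hd, inner_smul_left, inner_smul_right, horth i j hij, mul_zero, mul_zero]
  have hsum : Summable u := by
    refine (hfam.summable_iff_norm_sq_summable
      fun i => (⟨u i, Submodule.mem_span_singleton_self _⟩ : (ℂ ∙ u i))).2 (h.congr fun i => ?_)
    rw [Submodule.coe_norm, hu, norm_tensor, e.orthonormal.1 i, mul_one]
  refine ⟨∑' i, u i, fun φ ψ => ?_⟩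
  have h1 := hsum.hasSum.mapL (innerSL ℂ (tensor φ ψ))
  have h2 := e.hasSum_inner_mul_inner (ContinuousLinearMap.adjoint C φ) ψ
  rw [ContinuousLinearMap.adjoint_inner_left] at h2
  refine h1.unique ?_
  convert h2 using 2 with i
  rw [innerSL_apply_apply, hu, inner_tensor, ContinuousLinearMap.adjoint_inner_left]

/-- Trace class implies Hilbert-Schmidt: with C = S², the entries sum ‖S eᵢ‖², and ‖C eᵢ‖ ≤ ‖S‖ ‖S
eᵢ‖. -/
theorem summable_norm_sq_of_hasSum {C : L2 →L[ℂ] L2} (hC : C.IsPositive) {ι : Type*}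
    (e : HilbertBasis ι ℂ L2) {t : ℂ} (h : HasSum (fun i => inner ℂ (e i) (C (e i))) t) :
    Summable fun i => ‖C (e i)‖ ^ 2 := by
  obtain ⟨S, hS, rfl⟩ := exists_sqrt hC
  have h1 : Summable fun i => ‖S (e i)‖ ^ 2 := by
    refine (Complex.hasSum_re h).summable.congr fun i => ?_
    have : inner ℂ (e i) ((S * S) (e i)) = inner ℂ (S (e i)) (S (e i)) :=
      (hS.isSymmetric (e i) (S (e i))).symm
    rw [this]
    exact inner_self_eq_norm_sq (𝕜 := ℂ) _
  refine Summable.of_nonneg_of_le (fun i => by positivity) (fun i => ?_) (h1.mul_left (‖S‖ ^ 2))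
  rw [← mul_pow]
  exact pow_le_pow_left₀ (norm_nonneg _) (S.le_opNorm _) 2

/-- On each square the sets over which H integrates to zero form a Dynkin class, and rectangles are
a generating π-system; the squares exhaust the plane. -/
theorem ae_eq_zero_of_forall_rectangle {H : ℝ × ℝ → ℂ}
    (hH : ∀ R, IntegrableOn H (Set.Icc (-R) R ×ˢ Set.Icc (-R) R) (volume.prod volume))
    (h0 : ∀ (R : ℝ) (A B : Set ℝ), MeasurableSet A → MeasurableSet B → A ⊆ Set.Icc (-R) R →
      B ⊆ Set.Icc (-R) R → ∫ p in A ×ˢ B, H p ∂(volume.prod volume) = 0) :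
    H =ᵐ[volume.prod volume] 0 := by
  have key : ∀ n : ℕ, ∀ᵐ p ∂(volume.prod volume : Measure (ℝ × ℝ)),
      p ∈ Set.Icc (-(n:ℝ)) n ×ˢ Set.Icc (-(n:ℝ)) n → H p = 0 := by
    intro n
    have hm : MeasurableSet (Set.Icc (-(n:ℝ)) n ×ˢ Set.Icc (-(n:ℝ)) n) :=
      measurableSet_Icc.prod measurableSet_Icc
    rw [← ae_restrict_iff' hm]
    have hi : Integrable H ((volume.prod volume).restrict
      (Set.Icc (-(n:ℝ)) n ×ˢ Set.Icc (-(n:ℝ)) n)) := hH n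
    refine hi.ae_eq_zero_of_forall_setIntegral_eq_zero fun s hs hfin => ?_
    clear hfin
    have huniv : ∫ p, H p ∂((volume.prod volume).restrict
      (Set.Icc (-(n:ℝ)) n ×ˢ Set.Icc (-(n:ℝ)) n)) = 0 :=
      h0 n _ _ measurableSet_Icc measurableSet_Icc subset_rfl subset_rfl
    induction s, hs using MeasurableSpace.induction_on_inter generateFrom_prod.symm
      isPiSystem_prod with
    | empty => simp
    | basic t ht =>
      obtain ⟨A, hA, B, hB, rfl⟩ := ht
      have hA : MeasurableSet A := hA
      have hB : MeasurableSet B := hB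
      rw [Measure.restrict_restrict (hA.prod hB), Set.prod_inter_prod]
      exact h0 n _ _ (hA.inter measurableSet_Icc) (hB.inter measurableSet_Icc)
        Set.inter_subset_right Set.inter_subset_right
    | compl t ht ih => rw [setIntegral_compl ht hi, huniv, ih, sub_zero]
    | iUnion f hd hf ih =>
      rw [integral_iUnion hf hd hi.integrableOn]
      simp_rw [ih, tsum_zero]
  filter_upwards [ae_all_iff.2 key] with p hp
  obtain ⟨n, hn⟩ := exists_nat_ge (max |p.1| |p.2|)
  exact hp n ⟨abs_le.1 ((le_max_left _ _).trans hn), abs_le.1 ((le_max_right _ _).trans hn)⟩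

theorem integrable_tensor_mul (φ ψ : L2)
    (k : Lp ℂ 2 ((volume : Measure ℝ).prod (volume : Measure ℝ))) :
    Integrable (fun p : ℝ × ℝ => conj (φ p.1) * (k p * ψ p.2)) (volume.prod volume) := by
  refine (L2.integrable_inner (𝕜 := ℂ) (tensor φ ψ) k).congr ?_
  filter_upwards [(memLp_tensor φ ψ).coeFn_toLp] with p hp
  simp only [tensor, hp, RCLike.inner_apply, map_mul, RCLike.conj_conj]
  ring

theorem inner_tensor_eq_integral (φ ψ : L2)
    (k : Lp ℂ 2 ((volume : Measure ℝ).prod (volume : Measure ℝ))) :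
    inner ℂ (tensor φ ψ) k = ∫ p : ℝ × ℝ, conj (φ p.1) * (k p * ψ p.2) ∂(volume.prod volume) := by
  rw [L2.inner_def]
  refine integral_congr_ae ?_
  filter_upwards [(memLp_tensor φ ψ).coeFn_toLp] with p hp
  simp only [tensor, hp, RCLike.inner_apply, map_mul, RCLike.conj_conj]
  ring

/-- Taking indicators of sets of finite measure for φ turns the weak identity into equality of set
integrals. -/
theorem apply_ae_eq_integral_of_inner_tensor {C : L2 →L[ℂ] L2}
    {k : Lp ℂ 2 ((volume : Measure ℝ).prod (volume : Measure ℝ))}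
    (h : ∀ φ ψ : L2, inner ℂ (tensor φ ψ) k = inner ℂ φ (C ψ)) (ψ : L2) :
    ∀ᵐ x, C ψ x = ∫ y, k (x, y) * ψ y := by
  have ind : ∀ A : Set ℝ, MeasurableSet A → volume A < ∞ →
      MemLp (A.indicator fun _ => (1 : ℂ)) 2 volume := fun A hA hAf =>
    memLp_indicator_const 2 hA 1 (Or.inr hAf.ne)
  have e1 : ∀ A (hA : MeasurableSet A) (hAf : volume A < ∞),
      (fun p : ℝ × ℝ => conj (((ind A hA hAf).toLp _ : L2) p.1) * (k p * ψ p.2))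
        =ᵐ[volume.prod volume] fun p => (A.indicator fun _ => (1 : ℂ)) p.1 * (k p * ψ p.2) :=
    fun A hA hAf => by
      filter_upwards [Measure.quasiMeasurePreserving_fst.ae (ind A hA hAf).coeFn_toLp] with p hp
      rw [hp]
      simp only [Set.indicator]
      split_ifs <;> simp
  have e2 : ∀ (A : Set ℝ) (x : ℝ), ∫ y, (A.indicator fun _ => (1 : ℂ)) x * (k (x, y) * ψ y) =
      A.indicator (fun x => ∫ y, k (x, y) * ψ y) x := fun A x => by
    rw [integral_const_mul]
    simp only [Set.indicator]
    split_ifs <;> simp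
  have i1 : ∀ A (hA : MeasurableSet A) (hAf : volume A < ∞),
      Integrable (fun p : ℝ × ℝ => (A.indicator fun _ => (1 : ℂ)) p.1 * (k p * ψ p.2))
        (volume.prod volume) := fun A hA hAf => (integrable_tensor_mul _ ψ k).congr (e1 A hA hAf)
  refine ae_eq_of_forall_setIntegral_eq_of_sigmaFinite (fun A hA hAf => ?_) (fun A hA hAf => ?_)
    fun A hA hAf => ?_
  · have : Fact (volume A < ∞) := ⟨hAf⟩
    exact ((Lp.memLp (C ψ)).restrict A).integrable (by norm_num)
  · have := (i1 A hA hAf).integral_prod_left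
    simp_rw [e2] at this
    exact (integrable_indicator_iff hA).1 this
  · have h2 := h ((ind A hA hAf).toLp _) ψ
    rw [inner_tensor_eq_integral, integral_congr_ae (e1 A hA hAf), integral_prod _ (i1 A hA hAf)]
      at h2
    simp_rw [e2] at h2
    rw [integral_indicator hA] at h2
    rw [h2]
    exact (L2.inner_indicatorConstLp_one hA hAf.ne (C ψ)).symm

/-! ### The kernel of a positive commutator -/

section positive

variable {F G v w : ℝ → ℝ}

theorem setIntegral_kernel_eq_of_inner_tensor {C : L2 →L[ℂ] L2}
    {k : Lp ℂ 2 ((volume : Measure ℝ).prod (volume : Measure ℝ))}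
    (h : ∀ φ ψ : L2, inner ℂ (tensor φ ψ) k = inner ℂ φ (C ψ)) {A B : Set ℝ} {R : ℝ}
    (hA : MeasurableSet A) (hB : MeasurableSet B) (hAR : A ⊆ Set.Icc (-R) R)
    (hBR : B ⊆ Set.Icc (-R) R) :
    ∫ p in A ×ˢ B, k p ∂(volume.prod volume) =
      inner ℂ ((memLp_indicator_one hA hAR 2).toLp _)
        (C ((memLp_indicator_one hB hBR 2).toLp _)) := by
  rw [← h, inner_tensor_eq_integral, ← integral_indicator (hA.prod hB)]
  refine integral_congr_ae ?_
  filter_upwards [Measure.quasiMeasurePreserving_fst.ae (memLp_indicator_one hA hAR 2).coeFn_toLp,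
    Measure.quasiMeasurePreserving_snd.ae (memLp_indicator_one hB hBR 2).coeFn_toLp] with p h1 h2
  rw [h1, h2]
  by_cases ha : p.1 ∈ A <;> by_cases hb : p.2 ∈ B <;> simp [Set.indicator, ha, hb]

/-- Square integrability of K is not estimated directly: K agrees a.e. with the Hilbert-Schmidt
kernel of C because both have the matrix elements of C as their integrals over bounded rectangles.
-/
theorem kernel_hilbertSchmidt (hFm : Monotone F)
    (hFb : ∃ M, ∀ x, |F x| ≤ M) (hGm : Measurable G) (hGb : ∃ M, ∀ x, |G x| ≤ M)
    (hv : Measurable v) (hv0 : ∀ x, 0 ≤ v x)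
    (hvi : Integrable v) (hF : ∀ x, F x = F 0 + ∫ t in (0:ℝ)..x, v t)
    (hw : Measurable w) (hwi : Integrable w) (hG : ∀ x, G x = G 0 + ∫ t in (0:ℝ)..x, w t)
    {t : ℝ} (hC : IsTraceClassWithTrace (commutator F G hFm.measurable hFb hGm hGb) t) :
    MemLp (fun p : ℝ × ℝ => kernel F G hFm p.1 p.2) 2 (volume.prod volume) ∧
    ∀ ψ : L2, ∀ᵐ x, commutator F G hFm.measurable hFb hGm hGb ψ x =
      ∫ y, kernel F G hFm x y * ψ y := by
  obtain ⟨_, e, -⟩ := exists_hilbertBasis ℂ L2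
  obtain ⟨k, hk⟩ := exists_hilbertSchmidt_kernel _ e (summable_norm_sq_of_hasSum hC.1 e (hC.2 _ e))
  have hkl : ∀ R : ℝ, IntegrableOn k (Set.Icc (-R) R ×ˢ Set.Icc (-R) R) (volume.prod volume) := by
    intro R
    have : Fact ((volume.prod volume : Measure (ℝ × ℝ)) (Set.Icc (-R) R ×ˢ Set.Icc (-R) R) < ∞) :=
      ⟨by
        rw [Measure.prod_prod, Real.volume_Icc]
        exact ENNReal.mul_lt_top ENNReal.ofReal_lt_top ENNReal.ofReal_lt_top⟩
    exact ((Lp.memLp k).restrict _).integrable (by norm_num)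
  have hKl := integrableOn_kernel hFm hv hv0 hvi hF hw hwi hG
  have hKk : (fun p : ℝ × ℝ => kernel F G hFm p.1 p.2) =ᵐ[volume.prod volume] k := by
    rw [← sub_ae_eq_zero]
    refine ae_eq_zero_of_forall_rectangle (fun R => (hKl R).sub (hkl R))
      fun R A B hA hB hAR hBR => ?_
    have hs := Set.prod_mono hAR hBR
    have := integral_sub ((hKl R).mono_set hs) ((hkl R).mono_set hs)
    rw [setIntegral_kernel_eq_of_inner_tensor hk hA hB hAR hBR,
      inner_commutator_indicator_eq_integral_kernel hFm hFb hGm hGb hv hv0 hvi hF hw hwi hG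
        hA hB hAR hBR, sub_self] at this
    exact this
  refine ⟨(Lp.memLp k).ae_eq hKk.symm, fun ψ => ?_⟩
  filter_upwards [apply_ae_eq_integral_of_inner_tensor hk ψ,
    Measure.ae_ae_of_ae_prod hKk] with x h1 h2
  rw [h1]
  refine integral_congr_ae ?_
  filter_upwards [h2] with y hy
  rw [hy]

/-- The set of centres of balls of radius δ on which G is constant is closed by continuity. It is
also open: by hypothesis almost every point near a centre is a centre, and closedness adds the rest.
Since ℝ is connected, every point is a centre, so G is locally constant. -/
theorem eq_of_forall_ball_eq {δ : ℝ} (hδ : 0 < δ) (hGc : Continuous G) {x₀ : ℝ}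
    (h0 : ∀ y ∈ Metric.ball x₀ δ, G y = G x₀)
    (h : ∀ x, (∀ y ∈ Metric.ball x δ, G y = G x) →
      ∀ᵐ y, y ∈ Metric.ball x δ → ∀ z ∈ Metric.ball y δ, G z = G y) (x y : ℝ) : G x = G y := by
  set Z : Set ℝ := {x | ∀ y ∈ Metric.ball x δ, G y = G x} with hZ
  have hcl : IsClosed Z := by
    have : Z = ⋂ s ∈ Metric.ball (0:ℝ) δ, {x | G (x + s) = G x} := by
      ext x
      simp only [hZ, Set.mem_ofPred_eq, Set.mem_iInter]
      constructor
      · intro hx s hs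
        exact hx _ (by simpa [Real.dist_eq] using hs)
      · intro hx y hy
        have := hx (y - x) (by simpa [Real.dist_eq] using hy)
        rwa [add_sub_cancel] at this
    rw [this]
    exact isClosed_biInter fun s _ => isClosed_eq (by fun_prop) hGc
  have hop : IsOpen Z := by
    rw [Metric.isOpen_iff]
    intro x hx
    refine ⟨δ, hδ, fun y hy => ?_⟩
    have hd : y ∈ closure {y | y ∈ Metric.ball x δ → ∀ z ∈ Metric.ball y δ, G z = G y} :=
      (Measure.dense_of_ae (h x hx)) y
    rw [← hcl.closure_eq]
    rw [mem_closure_iff_nhds] at hd ⊢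
    intro t ht
    obtain ⟨u, hu1, hu2⟩ := hd (t ∩ Metric.ball x δ) (inter_mem ht (Metric.isOpen_ball.mem_nhds hy))
    exact ⟨u, hu1.1, hu2 hu1.2⟩
  have huniv : Z = Set.univ := IsClopen.eq_univ ⟨hcl, hop⟩ ⟨x₀, h0⟩
  have hloc : IsLocallyConstant G := (IsLocallyConstant.iff_eventually_eq G).2 fun x =>
    Metric.eventually_nhds_iff_ball.2 ⟨δ, hδ, by
      have : x ∈ Z := huniv ▸ Set.mem_univ x
      exact this⟩
  exact hloc.apply_eq_of_preconnectedSpace x y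

/-- On E = {w = 0} the range of C vanishes, so K(x, ·) = 0 for almost every x in E. The factor 𝓕(dF)
does not vanish near 0 unless dF = 0, hence G(y) = G(x) for |y - x| < δ. This self-propagating
condition either never holds, and then E is null, or makes G constant. -/
theorem density_pos_or_const (hFm : Monotone F)
    (hFb : ∃ M, ∀ x, |F x| ≤ M) (hGm : Measurable G) (hGb : ∃ M, ∀ x, |G x| ≤ M)
    (hv : Measurable v) (hv0 : ∀ x, 0 ≤ v x)
    (hvi : Integrable v) (hF : ∀ x, F x = F 0 + ∫ t in (0:ℝ)..x, v t)
    (hw : Measurable w) (hw0 : ∀ x, 0 ≤ w x) (hwi : Integrable w)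
    (hG : ∀ x, G x = G 0 + ∫ t in (0:ℝ)..x, w t)
    (hz : ∀ ψ, ∀ᵐ x, w x = 0 → commutator F G hFm.measurable hFb hGm hGb ψ x = 0) :
    (∀ᵐ x, 0 < w x) ∨ (∀ x y, F x = F y) ∨ ∀ x y, G x = G y := by
  by_cases hvz : v =ᵐ[volume] 0
  · refine Or.inr (Or.inl fun x y => ?_)
    have : ∀ x, ∫ t in (0:ℝ)..x, v t = 0 := fun x => by
      rw [intervalIntegral.integral_congr_ae (g := fun _ => 0) (hvz.mono fun x hx _ => hx)]
      simp
    rw [hF x, hF y, this, this]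
  have hGc := continuous_of_primitive hwi hG
  set E : Set ℝ := {x | w x = 0} with hE
  have hEm : MeasurableSet E := hw (measurableSet_singleton 0)
  have hKl := integrableOn_kernel hFm hv hv0 hvi hF hw hwi hG
  have hH : (E ×ˢ Set.univ).indicator (fun p : ℝ × ℝ => kernel F G hFm p.1 p.2)
      =ᵐ[volume.prod volume] 0 := by
    have hEu : MeasurableSet (E ×ˢ (Set.univ : Set ℝ)) := hEm.prod MeasurableSet.univ
    refine ae_eq_zero_of_forall_rectangle (fun R => (hKl R).indicator hEu)
      fun R A B hA hB hAR hBR => ?_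
    rw [setIntegral_indicator hEu, Set.prod_inter_prod, Set.inter_univ,
      ← inner_commutator_indicator_eq_integral_kernel hFm hFb hGm hGb hv hv0 hvi hF hw hwi hG
        (hA.inter hEm) hB (Set.inter_subset_left.trans hAR) hBR, L2.inner_def]
    refine integral_eq_zero_of_ae ?_
    filter_upwards [(memLp_indicator_one (hA.inter hEm)
      (Set.inter_subset_left.trans hAR) 2).coeFn_toLp, hz ((memLp_indicator_one hB hBR 2).toLp _)]
      with x h1 h2
    rw [h1]
    by_cases hx : x ∈ A ∩ E
    · rw [h2 hx.2]
      simp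
    · simp [Set.indicator, hx]
  -- At 0 the transform is the total mass of dF; continuity then provides a radius δ independent of
  -- x.
  have hpos : 𝓕 (fun r => (rescale v r : ℂ)) 0 ≠ 0 := by
    have h1 : 𝓕 (fun r => (rescale v r : ℂ)) 0 = ((∫ x, v x : ℝ) : ℂ) := by
      rw [Real.fourier_real_eq]
      simp only [mul_zero, neg_zero, AddChar.map_zero_eq_one, one_smul]
      refine (integral_ofReal (𝕜 := ℂ)).trans (congrArg _ ?_)
      refine (integral_const_mul _ _).trans ?_
      rw [Measure.integral_comp_mul_left v,
        abs_of_pos (inv_pos.2 (by positivity)), smul_eq_mul, ← mul_assoc,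
        mul_inv_cancel₀ (by positivity), one_mul]
    rw [h1, Complex.ofReal_ne_zero]
    intro h
    exact hvz ((integral_eq_zero_iff_of_nonneg hv0 hvi).1 h)
  obtain ⟨δ, hδ, hball⟩ := Metric.eventually_nhds_iff_ball.1
    ((continuous_fourier_rescale hvi).continuousAt.eventually_ne hpos)
  have hZ : ∀ᵐ x, w x = 0 → ∀ y ∈ Metric.ball x δ, G y = G x := by
    filter_upwards [Measure.ae_ae_of_ae_prod hH] with x hx hxE y hy
    have h1 : ∀ᵐ y, y ∈ Metric.ball x δ → G y = G x := by
      filter_upwards [hx] with y h1 h2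
      have h3 : kernel F G hFm x y = 0 := by
        rw [Set.indicator_of_mem (show (x, y) ∈ E ×ˢ Set.univ from ⟨hxE, trivial⟩)] at h1
        exact h1
      rw [kernel_eq hFm hv hv0 hvi hF] at h3
      have h4 : y - x ∈ Metric.ball (0:ℝ) δ := by
        simpa [Real.dist_eq] using h2
      have h5 := hball _ h4
      rcases mul_eq_zero.1 h3 with h6 | h6
      · rcases mul_eq_zero.1 h6 with h7 | h7
        · have : (1 / (2 * Real.pi)) ≠ 0 := by positivity
          exact absurd (Complex.ofReal_eq_zero.1 h7) this
        · exact absurd h7 h5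
      · rcases div_eq_zero_iff.1 (Complex.ofReal_eq_zero.1 h6) with h7 | h7
        · linarith
        · rw [sub_eq_zero.1 h7]
    have h2 : y ∈ closure {y | y ∈ Metric.ball x δ → G y = G x} := (Measure.dense_of_ae h1) y
    have hcl : IsClosed {y | G y = G x} := isClosed_eq hGc continuous_const
    change y ∈ {y | G y = G x}
    rw [← hcl.closure_eq]
    rw [mem_closure_iff_nhds] at h2 ⊢
    intro t ht
    obtain ⟨u, hu1, hu2⟩ := h2 (t ∩ Metric.ball x δ) (inter_mem ht (Metric.isOpen_ball.mem_nhds hy))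
    exact ⟨u, hu1.1, hu2 hu1.2⟩
  by_cases hne : ∃ x₀, ∀ y ∈ Metric.ball x₀ δ, G y = G x₀
  · obtain ⟨x₀, h0⟩ := hne
    refine Or.inr (Or.inr (eq_of_forall_ball_eq hδ hGc h0 fun x hx => ?_))
    -- Constancy of G on the ball makes w vanish a.e. there, and almost every zero of w is again the
    -- centre of such a ball.
    have h1 : ∫ t in Set.Ioo (x - δ) (x + δ), w t = 0 := by
      have h2 : G (x + δ) = G (x - δ) := by
        have hcl : IsClosed {y | G y = G x} := isClosed_eq hGc continuous_const
        have hsub : closure (Metric.ball x δ) ⊆ {y | G y = G x} := closure_minimal hx hcl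
        rw [closure_ball x hδ.ne'] at hsub
        have e1 : G (x + δ) = G x := hsub (by simp [abs_of_pos hδ])
        have e2 : G (x - δ) = G x := hsub (by simp [abs_of_pos hδ])
        rw [e1, e2]
      rw [← integral_Ioc_eq_integral_Ioo, ← intervalIntegral.integral_of_le (by linarith),
        integral_eq_sub_of_primitive hwi hG, h2, sub_self]
    rw [setIntegral_eq_zero_iff_of_nonneg_ae (ae_of_all _ hw0) hwi.integrableOn,
      Filter.EventuallyEq, ae_restrict_iff' measurableSet_Ioo] at h1
    filter_upwards [h1, hZ] with y h2 h3 hy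
    rw [Real.ball_eq_Ioo] at hy
    exact h3 (h2 hy)
  · push Not at hne
    left
    filter_upwards [hZ] with x hx
    refine (hw0 x).lt_of_ne' fun h => ?_
    obtain ⟨y, hy, hy2⟩ := hne x
    exact hy2 (hx h y hy)

theorem strictMono_of_density_pos (hw : ∀ᵐ x, 0 < w x) (hwi : Integrable w)
    (hG : ∀ x, G x = G 0 + ∫ t in (0:ℝ)..x, w t) : StrictMono G := by
  intro x y hxy
  have h : 0 < ∫ t in x..y, w t := by
    rw [intervalIntegral.integral_of_le hxy.le, setIntegral_pos_iff_support_of_nonneg_ae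
      (ae_restrict_of_ae (hw.mono fun _ h => h.le)) hwi.integrableOn]
    have : volume (Function.support w ∩ Set.Ioc x y) = volume (Set.Ioc x y) := by
      refine measure_congr ?_
      filter_upwards [hw] with t ht
      exact propext ⟨fun h => h.2, fun h => ⟨ht.ne', h⟩⟩
    rw [this, Real.volume_Ioc]
    simpa using hxy
  rw [integral_eq_sub_of_primitive hwi hG] at h
  linarith

end positive

/-! ### Absolute continuity of the inverse function -/

/-- Let ν = w dx. Since w > 0 a.e., Lebesgue measure is w⁻¹ν. The inverse takes an interval of
length ℓ to one of ν-measure ℓ, so the claim is absolute continuity of the integral of w⁻¹ with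
respect to ν over the compact interval J, where this integral is the finite length of J. -/
theorem inverseAbsolutelyContinuous_of_density_pos {G w : ℝ → ℝ} (hwm : Measurable w)
    (hw : ∀ᵐ x, 0 < w x) (hwi : Integrable w)
    (hG : ∀ x, G x = G 0 + ∫ t in (0:ℝ)..x, w t) : InverseAbsolutelyContinuous G := by
  intro c hc d hd
  have hmono := strictMono_of_density_pos hw hwi hG
  have hrange : ∀ y ∈ Set.uIcc c d, G (Function.invFun G y) = y := fun y hy =>
    Function.invFun_eq ((isPreconnected_range (continuous_of_primitive hwi hG)).ordConnected.uIcc_subset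
      hc hd hy)
  set I := Function.invFun G with hI
  set ν : Measure ℝ := volume.withDensity fun x => ENNReal.ofReal (w x) with hν
  set J : Set ℝ := Set.uIcc (I c) (I d) with hJ
  have key : ∀ U, MeasurableSet U → ∫⁻ x in U, (ENNReal.ofReal (w x))⁻¹ ∂ν = volume U := by
    intro U hU
    refine (setLIntegral_withDensity_eq_setLIntegral_mul _ hwm.ennreal_ofReal
      hwm.ennreal_ofReal.inv hU).trans ?_
    rw [← setLIntegral_one]
    refine lintegral_congr_ae (ae_restrict_of_ae ?_)
    filter_upwards [hw] with x hx
    exact ENNReal.mul_inv_cancel (by simpa using hx) ENNReal.ofReal_ne_top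
  have hνI : ∀ a b, a ∈ Set.uIcc c d → b ∈ Set.uIcc c d →
      ν (Set.uIoc (I a) (I b)) = ENNReal.ofReal (dist a b) := by
    intro a b ha hb
    have h1 : ∀ x y, x ≤ y → ν (Set.Ioc x y) = ENNReal.ofReal (G y - G x) := fun x y hxy => by
      rw [hν, withDensity_apply _ measurableSet_Ioc, ← integral_eq_sub_of_primitive hwi hG,
        intervalIntegral.integral_of_le hxy, ofReal_integral_eq_lintegral_ofReal hwi.integrableOn
          (ae_restrict_of_ae (hw.mono fun _ h => h.le))]
    rcases le_total (I a) (I b) with h | h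
    · rw [Set.uIoc_of_le h, h1 _ _ h, hrange a ha, hrange b hb, dist_comm, Real.dist_eq,
        abs_of_nonneg]
      rw [← hrange a ha, ← hrange b hb, sub_nonneg]
      exact hmono.monotone h
    · rw [Set.uIoc_of_ge h, h1 _ _ h, hrange a ha, hrange b hb, Real.dist_eq, abs_of_nonneg]
      rw [← hrange a ha, ← hrange b hb, sub_nonneg]
      exact hmono.monotone h
  have hpre : ∀ a b, a ∈ Set.uIcc c d → b ∈ Set.uIcc c d →
      Set.uIoc (I a) (I b) = G ⁻¹' Set.uIoc a b := by
    intro a b ha hb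
    ext x
    conv_rhs => rw [← hrange a ha, ← hrange b hb]
    simp only [Set.mem_uIoc, Set.mem_preimage, hmono.lt_iff_lt, hmono.le_iff_le]
  have hIJ : ∀ a, a ∈ Set.uIcc c d → I a ∈ J := by
    intro a ha
    have h1 : G (I a) ∈ Set.uIcc (G (I c)) (G (I d)) := by
      rwa [hrange a ha, hrange c Set.left_mem_uIcc, hrange d Set.right_mem_uIcc]
    simpa only [hJ, Set.mem_uIcc, hmono.le_iff_le] using h1
  rw [absolutelyContinuousOnInterval_iff]
  intro ε hε
  have hfin : ∫⁻ x, (ENNReal.ofReal (w x))⁻¹ ∂(ν.restrict J) ≠ ∞ := by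
    rw [key J measurableSet_uIcc, hJ, Set.uIcc, Real.volume_Icc]
    exact ENNReal.ofReal_ne_top
  obtain ⟨δ, hδ, hδε⟩ := exists_pos_setLIntegral_lt_of_measure_lt hfin
    (ENNReal.ofReal_pos.2 hε).ne'
  -- The threshold δ is an extended real and may be infinite; the minimum with 1 makes it a real
  -- number.
  have hmin : min δ 1 ≠ ∞ := (min_le_right _ _).trans_lt ENNReal.one_lt_top |>.ne
  refine ⟨(min δ 1).toReal, ENNReal.toReal_pos (lt_min hδ one_pos).ne' hmin, ?_⟩
  rintro ⟨n, E⟩ ⟨hE1, hE2⟩ hsum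
  simp only at hE1 hE2 hsum ⊢
  set U : Set ℝ := ⋃ i ∈ Finset.range n, Set.uIoc (I (E i).1) (I (E i).2) with hU
  have hUm : MeasurableSet U :=
    Finset.measurableSet_biUnion _ fun i _ => measurableSet_uIoc
  have hUJ : U ⊆ J := Set.iUnion₂_subset fun i hi =>
    Set.uIoc_subset_uIcc.trans (Set.uIcc_subset_uIcc (hIJ _ (hE1 i hi).1) (hIJ _ (hE1 i hi).2))
  have hdisj : Set.PairwiseDisjoint (Finset.range n : Set ℕ)
      fun i => Set.uIoc (I (E i).1) (I (E i).2) := by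
    intro i hi j hj hij
    have := (hE2 hi hj hij).preimage G
    simp only [Function.onFun]
    rwa [hpre _ _ (hE1 i hi).1 (hE1 i hi).2, hpre _ _ (hE1 j hj).1 (hE1 j hj).2]
  have hsumU : ∀ μ : Measure ℝ, μ U = ∑ i ∈ Finset.range n, μ (Set.uIoc (I (E i).1) (I (E i).2)) :=
    fun μ => measure_biUnion_finset hdisj fun i _ => measurableSet_uIoc
  have h1 : (ν.restrict J) U < δ := by
    rw [Measure.restrict_apply hUm, Set.inter_eq_left.2 hUJ, hsumU,
      Finset.sum_congr rfl fun i hi => hνI _ _ (hE1 i hi).1 (hE1 i hi).2,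
      ← ENNReal.ofReal_sum_of_nonneg fun i _ => dist_nonneg]
    exact ((ENNReal.ofReal_lt_iff_lt_toReal (Finset.sum_nonneg fun i _ => dist_nonneg) hmin).2
      hsum).trans_le (min_le_left _ _)
  have h2 := hδε U h1
  rw [Measure.restrict_restrict hUm, Set.inter_eq_left.2 hUJ, key U hUm, hsumU] at h2
  simp_rw [Real.volume_uIoc] at h2
  rw [← ENNReal.ofReal_sum_of_nonneg fun i _ => abs_nonneg _, ENNReal.ofReal_lt_ofReal_iff hε] at h2
  refine lt_of_eq_of_lt (Finset.sum_congr rfl fun i _ => ?_) h2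
  rw [dist_comm, Real.dist_eq]

/-! ### The pair of functions after exchanging position and momentum -/

section swap

variable {f g : ℝ → ℝ} (hf : Measurable f) (hfb : ∃ M, ∀ x, |f x| ≤ M)
  (hg : Measurable g) (hgb : ∃ M, ∀ x, |g x| ≤ M)
  (hf' : Measurable fun x => g (x / (2 * Real.pi)))
  (hfb' : ∃ M, ∀ x, |g (x / (2 * Real.pi))| ≤ M)
  (hg' : Measurable fun x => - f (-(2 * Real.pi * x)))
  (hgb' : ∃ M, ∀ x, |(- f (-(2 * Real.pi * x)))| ≤ M)

theorem isPositive_commutator_swap (hC : (commutator f g hf hfb hg hgb).IsPositive) :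
    (commutator (fun x => g (x / (2 * Real.pi))) (fun x => - f (-(2 * Real.pi * x)))
      hf' hfb' hg' hgb').IsPositive := by
  have h := (LinearMap.isPositive_linearIsometryEquiv_conj_iff FT.symm).2 hC.toLinearMap
  rw [← ContinuousLinearMap.isPositive_toLinearMap_iff]
  convert h using 1
  ext1 ψ
  exact commutator_swap hf hfb hg hgb hf' hfb' hg' hgb' ψ

theorem commutator_swap_ne_zero (hne : commutator f g hf hfb hg hgb ≠ 0) :
    commutator (fun x => g (x / (2 * Real.pi))) (fun x => - f (-(2 * Real.pi * x)))
      hf' hfb' hg' hgb' ≠ 0 := by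
  intro h
  refine hne (ContinuousLinearMap.ext fun ψ => ?_)
  have h1 := commutator_swap hf hfb hg hgb hf' hfb' hg' hgb' (FT.symm ψ)
  rw [h, LinearIsometryEquiv.apply_symm_apply] at h1
  simpa using congrArg FT h1.symm

end swap

/-! ### Rescaled densities and strict positivity for a nonzero commutator -/

theorem primitive_comp_mul {G w : ℝ → ℝ} (hG : ∀ x, G x = G 0 + ∫ t in (0:ℝ)..x, w t)
    {a : ℝ} (ha : a ≠ 0) (b x : ℝ) :
    b * G (a * x) = b * G (a * 0) + ∫ t in (0:ℝ)..x, b * a * w (a * t) := by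
  rw [intervalIntegral.integral_const_mul, intervalIntegral.integral_comp_mul_left w ha, hG (a * x),
    mul_zero, smul_eq_mul]
  field_simp

theorem ae_comp_mul_left {p : ℝ → Prop} (h : ∀ᵐ x, p x) {a : ℝ} (ha : a ≠ 0) : ∀ᵐ x, p (a * x) := by
  have : Measure.QuasiMeasurePreserving (fun x : ℝ => a * x) volume volume := by
    refine ⟨measurable_const_mul _, ?_⟩
    rw [Real.map_volume_mul_left ha]
    exact Measure.smul_absolutelyContinuous
  exact this.ae h

/-- The degenerate alternatives of `density_pos_or_const` are excluded by C ≠ 0: F constant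
contradicts [F] > 0, and G constant makes the kernel zero. The density of F is an input, that of G
an output, so using this for both functions requires the exchanged pair. -/
theorem exists_density_pos {F G v : ℝ → ℝ} (hFm : Monotone F) (hFb : ∃ M, ∀ x, |F x| ≤ M)
    (hG : Measurable G) (hGb : ∃ M, ∀ x, |G x| ≤ M)
    (hGc : Continuous G) (hGm : Monotone G)
    (hv : Measurable v) (hv0 : ∀ x, 0 ≤ v x)
    (hvi : Integrable v) (hF : ∀ x, F x = F 0 + ∫ t in (0:ℝ)..x, v t)
    (hC : (commutator F G hFm.measurable hFb hG hGb).IsPositive)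
    (hne : commutator F G hFm.measurable hFb hG hGb ≠ 0) :
    ∃ w : ℝ → ℝ, Measurable w ∧ (∀ x, 0 ≤ w x) ∧ (∀ᵐ x, 0 < w x) ∧ Integrable w ∧
      (∀ x, G x = G 0 + ∫ t in (0:ℝ)..x, w t) ∧
      MemLp (fun p : ℝ × ℝ => kernel F G hFm p.1 p.2) 2 (volume.prod volume) ∧
      ∀ ψ : L2, ∀ᵐ x, commutator F G hFm.measurable hFb hG hGb ψ x =
        ∫ y, kernel F G hFm x y * ψ y := by
  obtain ⟨⟨w, hw, hw0, hwi, hGw, hz⟩, ht⟩ :=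
    exists_density hFm.measurable hFb hG hGb hFm hGc hGm hC hne
  have hK := kernel_hilbertSchmidt hFm hFb hG hGb hv hv0 hvi hF hw hwi hGw ht
  refine ⟨w, hw, hw0, ?_, hwi, hGw, hK⟩
  rcases density_pos_or_const hFm hFb hG hGb hv hv0 hvi hF hw hw0 hwi hGw hz with h | h | h
  · exact h
  · exfalso
    have := totalIncrease_pos_of_ne_zero hFm.measurable hFb hG hGb hFm hC hne
    have hc : F = fun _ => F 0 := funext fun x => h x 0
    rw [hc, totalIncrease, ciSup_const, ciInf_const, sub_self] at this
    exact lt_irrefl _ this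
  · refine absurd (ContinuousLinearMap.ext fun ψ => Lp.ext ?_) hne
    filter_upwards [hK.2 ψ, Lp.coeFn_zero ℂ 2 (volume : Measure ℝ)] with x h1 h2
    have h3 : ∀ y, kernel F G hFm x y = 0 := fun y => by
      simp [kernel, h x y]
    rw [h1, zero_apply, h2]
    simp [h3]

/-- The two functions agree on a dense set, so each value of the monotone one lies between two
values of the bounded one. -/
theorem bounded_of_ae_eq {f f₀ : ℝ → ℝ} (hfb : ∃ M, ∀ x, |f x| ≤ M) (hmono : Monotone f₀)
    (h : f₀ =ᵐ[volume] f) : ∃ M, ∀ x, |f₀ x| ≤ M := by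
  obtain ⟨M, hM⟩ := hfb
  have hd : Dense {x | f₀ x = f x} := Measure.dense_of_ae h
  refine ⟨M, fun x => abs_le.2 ⟨?_, ?_⟩⟩
  · obtain ⟨y, hy, hyx⟩ := hd.exists_lt x
    have hy : f₀ y = f y := hy
    exact (abs_le.1 (hM y)).1.trans (hy ▸ hmono hyx.le)
  · obtain ⟨y, hy, hyx⟩ := hd.exists_gt x
    have hy : f₀ y = f y := hy
    exact (hy ▸ hmono hyx.le : f₀ x ≤ f y).trans (abs_le.1 (hM y)).2

end KatoCommutator

end

/-! ### The theorem: regularity of g, then of f by exchange, then positivity of both densities -/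

theorem theorem1p5 (f g : ℝ → ℝ)
    (hf : Measurable f) (hfb : ∃ M, ∀ x, |f x| ≤ M)
    (hg : Measurable g) (hgb : ∃ M, ∀ x, |g x| ≤ M)
    (hf_incr : ∃ f₀ : ℝ → ℝ, Monotone f₀ ∧ f₀ =ᵐ[volume] f)
    (hg_incr : ∃ g₀ : ℝ → ℝ, Monotone g₀ ∧ g₀ =ᵐ[volume] g)
    (hC_pos : (KatoCommutator.commutator f g hf hfb hg hgb).IsPositive)
    (hC_ne : KatoCommutator.commutator f g hf hfb hg hgb ≠ 0) :
    ∃ (F G : ℝ → ℝ) (hF : StrictMono F) (_ : StrictMono G),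
      F =ᵐ[volume] f ∧ G =ᵐ[volume] g ∧ Continuous F ∧ Continuous G ∧
      KatoCommutator.InverseAbsolutelyContinuous F ∧
      KatoCommutator.InverseAbsolutelyContinuous G ∧
      MemLp (fun p : ℝ × ℝ => KatoCommutator.kernel F G hF.monotone p.1 p.2) 2
        ((volume : Measure ℝ).prod volume) ∧
      (∀ ψ : KatoCommutator.L2, ∀ᵐ x : ℝ,
        KatoCommutator.commutator f g hf hfb hg hgb ψ x =
          ∫ y, KatoCommutator.kernel F G hF.monotone x y * ψ y) ∧
      KatoCommutator.IsTraceClassWithTrace (KatoCommutator.commutator f g hf hfb hg hgb)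
        (KatoCommutator.totalIncrease F * KatoCommutator.totalIncrease G / (2 * Real.pi)) := by
  have hpi := Real.pi_pos
  have h2pi : 2 * Real.pi ≠ 0 := by positivity
  obtain ⟨f₀, hf₀, hff⟩ := hf_incr
  have hf₀b := KatoCommutator.bounded_of_ae_eq hfb hf₀ hff
  have e₀ := KatoCommutator.commutator_congr hf hfb hg hgb hf₀.measurable hf₀b hg hgb hff.symm (ae_eq_refl g)
  obtain ⟨G, hGc, hGm, hGb, hGg⟩ := KatoCommutator.exists_continuous_representative hf₀.measurable hf₀b hg hgb hf₀
    (e₀ ▸ hC_pos) (e₀ ▸ hC_ne)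
  have e₁ := KatoCommutator.commutator_congr hf hfb hg hgb hf₀.measurable hf₀b hGc.measurable hGb hff.symm hGg.symm
  -- the exchanged pair for a bounded measurable function in the place of `f`
  have hfm' : Monotone fun x => G (x / (2 * Real.pi)) := fun x y hxy => hGm (by gcongr)
  have hfb' : ∃ M, ∀ x, |G (x / (2 * Real.pi))| ≤ M := hGb.imp fun _ h x => h _
  have hgm' : ∀ {u : ℝ → ℝ}, Measurable u → Measurable fun x => - u (-(2 * Real.pi * x)) :=
    fun hu => (hu.comp (measurable_const_mul _).neg).neg
  have hgb' : ∀ {u : ℝ → ℝ}, (∃ M, ∀ x, |u x| ≤ M) → ∃ M, ∀ x, |(- u (-(2 * Real.pi * x)))| ≤ M :=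
    fun hu => hu.imp fun _ h x => (abs_neg _).trans_le (h _)
  -- In the exchanged pair the second function is a reflected and rescaled f₀; its continuous
  -- representative is H.
  obtain ⟨H, hHc, hHm, hHb, hHf⟩ := KatoCommutator.exists_continuous_representative hfm'.measurable hfb'
    (hgm' hf₀.measurable) (hgb' hf₀b) hfm'
    (KatoCommutator.isPositive_commutator_swap hf₀.measurable hf₀b hGc.measurable hGb _ _ _ _ (e₁ ▸ hC_pos))
    (KatoCommutator.commutator_swap_ne_zero hf₀.measurable hf₀b hGc.measurable hGb _ _ _ _ (e₁ ▸ hC_ne))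
  -- Multiplication by a inverts x ↦ -2πx, so F(x) = -H(ax) undoes the exchange.
  set a : ℝ := -(2 * Real.pi)⁻¹ with ha
  have ha0 : a ≠ 0 := neg_ne_zero.2 (inv_ne_zero h2pi)
  have haneg : a < 0 := neg_neg_of_pos (by positivity)
  have hapi : ∀ x, -(2 * Real.pi * (a * x)) = x := fun x => by
    rw [ha]
    field_simp
  set F : ℝ → ℝ := fun x => -1 * H (a * x) with hFdef
  have hFc : Continuous F := by fun_prop
  have hFm : Monotone F := fun x y hxy => by
    have := hHm (mul_le_mul_of_nonpos_left hxy haneg.le)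
    simp only [hFdef]
    linarith
  have hFb : ∃ M, ∀ x, |F x| ≤ M := hHb.imp fun _ h x => by
    change |(-1 * H (a * x))| ≤ _
    rw [neg_one_mul, abs_neg]
    exact h _
  have hFf : F =ᵐ[volume] f := by
    filter_upwards [KatoCommutator.ae_comp_mul_left hHf ha0, hff] with x h1 h2
    change -1 * H (a * x) = f x
    rw [h1, hapi, neg_one_mul, neg_neg, h2]
  have hHF : (fun x => - F (-(2 * Real.pi * x))) = H := by
    funext x
    have : a * (-(2 * Real.pi * x)) = x := by
      rw [ha]
      field_simp
    simp only [hFdef, this]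
    ring
  have e₂ := KatoCommutator.commutator_congr hf hfb hg hgb hFm.measurable hFb hGc.measurable hGb
    hFf.symm hGg.symm
  have hC₂ := e₂ ▸ hC_pos
  have hne₂ := e₂ ▸ hC_ne
  have hC₃ := KatoCommutator.isPositive_commutator_swap hFm.measurable hFb hGc.measurable hGb hfm'.measurable hfb'
    (hgm' hFm.measurable) (hgb' hFb) hC₂
  have hne₃ := KatoCommutator.commutator_swap_ne_zero hFm.measurable hFb hGc.measurable hGb hfm'.measurable hfb'
    (hgm' hFm.measurable) (hgb' hFb) hne₂
  -- This gives the trace and some density of G, not yet known to be positive. It suffices as the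
  -- input density for the exchanged pair.
  obtain ⟨⟨w, hw, hw0, hwi, hGw, -⟩, ht⟩ :=
    KatoCommutator.exists_density hFm.measurable hFb hGc.measurable hGb hFm hGc hGm hC₂ hne₂
  -- The density of H obtained here is positive a.e., and yields a positive density -a u(at) of F
  -- because a < 0.
  obtain ⟨u, hu, hu0, hupos, hui, hHu, -⟩ := KatoCommutator.exists_density_pos (v := fun x => (2 * Real.pi)⁻¹ *
      w ((2 * Real.pi)⁻¹ * x)) hfm' hfb' (hgm' hFm.measurable) (hgb' hFb)
    (by rw [hHF]; exact hHc) (by rw [hHF]; exact hHm)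
    ((hw.comp (measurable_const_mul _)).const_mul _)
    (fun x => mul_nonneg (by positivity) (hw0 _))
    ((hwi.comp_mul_left' (inv_ne_zero h2pi)).const_mul _)
    (fun x => by
      have := KatoCommutator.primitive_comp_mul hGw (inv_ne_zero h2pi) 1 x
      simpa only [one_mul, div_eq_inv_mul] using this) hC₃ hne₃
  simp only [congrFun hHF] at hHu
  have hFv : ∀ x, F x = F 0 + ∫ t in (0:ℝ)..x, -1 * a * u (a * t) :=
    KatoCommutator.primitive_comp_mul hHu ha0 (-1)
  have hv : Measurable fun t => -1 * a * u (a * t) := (hu.comp (measurable_const_mul _)).const_mul _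
  have hvi : Integrable fun t => -1 * a * u (a * t) := (hui.comp_mul_left' ha0).const_mul _
  have hvpos : ∀ᵐ t, 0 < -1 * a * u (a * t) := by
    filter_upwards [KatoCommutator.ae_comp_mul_left hupos ha0] with t h
    exact mul_pos (by linarith) h
  -- With a density of F available, the original pair gives the positive density of G and the
  -- kernel.
  obtain ⟨w', hw', -, hwpos', hwi', hGw', hK2, hK⟩ := KatoCommutator.exists_density_pos hFm hFb hGc.measurable hGb
    hGc hGm hv (fun t => mul_nonneg (by linarith) (hu0 _)) hvi hFv hC₂ hne₂
  refine ⟨F, G, KatoCommutator.strictMono_of_density_pos hvpos hvi hFv, KatoCommutator.strictMono_of_density_pos hwpos' hwi' hGw',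
    hFf, hGg, hFc, hGc, KatoCommutator.inverseAbsolutelyContinuous_of_density_pos hv hvpos hvi hFv,
    KatoCommutator.inverseAbsolutelyContinuous_of_density_pos hw' hwpos' hwi' hGw', hK2, ?_, ?_⟩
  · rw [e₂]
    exact hK
  · rw [e₂]
    exact ht
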